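/- Let $H$ be a separable complex Hilbert space and let $\mathcal{CF}^{\mathrm{sa}}$ be the set of all (generally unbounded) self-adjoint Fredholm operators in $H$, with the gap metric $\delta(T_1,T_2)=\|P_1-P_2\|$, where $P_j$ is the orthogonal projection of $H\times H$ onto the graph of $T_j$. For a self-adjoint operator $T$ let $1_{[a,b]}(T)$ be its spectral projection for $[a,b]$. If $E$ is a finite-rank spectral projection of $T$, let $E^{\ge}$ be the projection onto the subspace of $E(H)$ spanned by those eigenvectors of $T$ in $E(H)$ that have non-negative eigenvalues. Let $f:[0,1]\to\mathcal{CF}^{\mathrm{sa}}$ be continuous. Then the spectral flow of $f$ is well defined, in the following sense. (i) There are a partition $0=t_0<t_1<\dots<t_n=1$ and real numbers $\varepsilon_1,\dots,\varepsilon_n>0$ such that, for each $j=1,\dots,n$, the function $t\mapsto E_j(t):=1_{[-\varepsilon_j,\varepsilon_j]}(f(t))$ is norm continuous and of finite rank on $[t_{j-1},t_j]$. (ii) The integer $$\sum_{j=1}^n\Bigl(\dim E_j^{\ge}(t_j)-\dim E_j^{\ge}(t_{j-1})\Bigr)$$ is the same for all choices of a partition and of numbers $\varepsilon_j$ as in (i);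 that is, it depends only on $f$. -/

import Mathlib

open scoped InnerProductSpace NNReal Topology unitInterval
open Filter

namespace GapFlow

noncomputable section

variable {H : Type*} [NormedAddCommGroup H] [InnerProductSpace ℂ H]

/-! ### Self-adjoint operators, the graph, and the gap metric -/

/-- The graph of `T` as a subspace of the Hilbert space `H ⊕ H` (with the `ℓ²`-norm). -/
def graphSubspace (T : H →ₗ.[ℂ] H) : Submodule ℂ (WithLp 2 (H × H)) :=
  T.graph.comap (WithLp.linearEquiv 2 ℂ (H × H)).toLinearMap

theorem mem_graphSubspace_iff (T : H →ₗ.[ℂ] H) (v : WithLp 2 (H × H)) :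
    v ∈ graphSubspace T ↔ (v.fst, v.snd) ∈ T.graph := Iff.rfl

variable [CompleteSpace H]

theorem isClosed_graphSubspace {T : H →ₗ.[ℂ] H} (hT : IsSelfAdjoint T) :
    IsClosed (graphSubspace T : Set (WithLp 2 (H × H))) := by
  have h : IsClosed (T.graph : Set (H × H)) := hT.isClosed
  exact h.preimage (WithLp.prod_continuous_ofLp 2 H H)

/-- A densely defined closed operator `T` is Fredholm if its kernel is finite-dimensional and its
range is closed and of finite codimension.  (Only applied to self-adjoint operators, which are
densely defined and closed.) -/
structure IsFredholm (T : H →ₗ.[ℂ] H) : Prop where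
  finiteDimensional_ker : FiniteDimensional ℂ (LinearMap.ker T.toFun)
  isClosed_range : IsClosed (LinearMap.range T.toFun : Set H)
  finiteDimensional_coker : FiniteDimensional ℂ (H ⧸ LinearMap.range T.toFun)

variable (H) in
/-- The set of (generally unbounded) self-adjoint Fredholm operators in `H`. -/
structure CFsa where
  /-- the underlying partially defined operator -/
  op : H →ₗ.[ℂ] H
  isSelfAdjoint : IsSelfAdjoint op
  isFredholm : IsFredholm op

/-- The orthogonal projection of `H ⊕ H` onto the graph of `T`. -/
def graphProjection (T : CFsa H) : WithLp 2 (H × H) →L[ℂ] WithLp 2 (H × H) :=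
  haveI : CompleteSpace (graphSubspace T.op) :=
    (isClosed_graphSubspace T.isSelfAdjoint).completeSpace_coe
  (graphSubspace T.op).starProjection

theorem graphProjection_injective :
    Function.Injective (graphProjection : CFsa H → _) := by
  intro S T h
  have : CompleteSpace (graphSubspace S.op) :=
    (isClosed_graphSubspace S.isSelfAdjoint).completeSpace_coe
  have : CompleteSpace (graphSubspace T.op) :=
    (isClosed_graphSubspace T.isSelfAdjoint).completeSpace_coe
  have h1 : graphSubspace S.op = graphSubspace T.op := by
    rw [← (graphSubspace S.op).range_starProjection, ← (graphSubspace T.op).range_starProjection]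
    exact congrArg (fun P : WithLp 2 (H × H) →L[ℂ] WithLp 2 (H × H) => P.range) h
  have h2 : S.op.graph = T.op.graph := by
    ext p
    exact SetLike.ext_iff.mp h1 (WithLp.toLp 2 p)
  have h3 : S.op = T.op := LinearPMap.eq_of_eq_graph h2
  cases S; cases T; cases h3; rfl

/-- The gap metric: the distance of `S` and `T` is the operator norm of the difference of the
orthogonal projections onto their graphs. -/
instance : MetricSpace (CFsa H) :=
  MetricSpace.induced graphProjection graphProjection_injective inferInstance

theorem dist_eq (S T : CFsa H) : dist S T = ‖graphProjection S - graphProjection T‖ :=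
  dist_eq_norm (graphProjection S) (graphProjection T)

/-! ### The Cayley transform -/

theorem symmetric_of_isSelfAdjoint {T : H →ₗ.[ℂ] H} (hT : IsSelfAdjoint T) (x y : T.domain) :
    ⟪T x, (y : H)⟫_ℂ = ⟪(x : H), T y⟫_ℂ := by
  have h := LinearPMap.adjoint_isFormalAdjoint hT.dense_domain
  rw [LinearPMap.isSelfAdjoint_def.mp hT] at h
  exact h x y

theorem exists_add_smul_eq {T : H →ₗ.[ℂ] H} (hT : IsSelfAdjoint T) {c : ℂ} (hc : c * c = -1)
    (y : H) : ∃ z : T.domain, T z + c • (z : H) = y := by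
  have : CompleteSpace (graphSubspace T) := (isClosed_graphSubspace hT).completeSpace_coe
  set P := (graphSubspace T).starProjection with hP
  set v : WithLp 2 (H × H) := WithLp.toLp 2 ((0 : H), y) with hv
  have h1 : P v ∈ graphSubspace T := Submodule.starProjection_apply_mem _ _
  have h2 : v - P v ∈ (graphSubspace T)ᗮ := Submodule.sub_starProjection_mem_orthogonal _
  rw [mem_graphSubspace_iff, LinearPMap.mem_graph_iff] at h1
  obtain ⟨x, hx1, hx2⟩ := h1
  simp only at hx1 hx2
  have h3 : ∀ w : T.domain, ⟪(x : H), (w : H)⟫_ℂ = ⟪y - T x, T w⟫_ℂ := by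
    intro w
    have hw : WithLp.toLp 2 ((w : H), T w) ∈ graphSubspace T := LinearPMap.mem_graph T w
    have h4 := (Submodule.mem_orthogonal' _ _).mp h2 _ hw
    rw [WithLp.prod_inner_apply] at h4
    simp only [WithLp.ofLp_sub, Prod.fst_sub, Prod.snd_sub, inner_sub_left, hv] at h4
    change ⟪(0 : H), (w : H)⟫_ℂ - ⟪(P v).fst, (w : H)⟫_ℂ + (⟪y, T w⟫_ℂ - ⟪(P v).snd, T w⟫_ℂ) = 0
      at h4
    rw [← hx1, ← hx2, inner_zero_left] at h4
    rw [inner_sub_left]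
    linear_combination -h4
  have hd : y - T x ∈ T.adjoint.domain := LinearPMap.mem_adjoint_domain_of_exists _ ⟨x, h3⟩
  have ha : T.adjoint ⟨y - T x, hd⟩ = x := LinearPMap.adjoint_apply_eq hT.dense_domain _ h3
  have hg : (y - T x, (x : H)) ∈ T.adjoint.graph :=
    (LinearPMap.mem_graph_iff _).mpr ⟨⟨_, hd⟩, rfl, ha⟩
  rw [LinearPMap.isSelfAdjoint_def.mp hT] at hg
  obtain ⟨b, hb1, hb2⟩ := (LinearPMap.mem_graph_iff _).mp hg
  simp only at hb1 hb2
  refine ⟨x - c • b, ?_⟩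
  rw [LinearPMap.map_sub, LinearPMap.map_smul, hb2]
  push_cast
  rw [hb1, smul_sub, smul_smul, hc]
  module

theorem norm_sub_I_eq {T : H →ₗ.[ℂ] H} (hT : IsSelfAdjoint T) (x : T.domain) :
    ‖T x - Complex.I • (x : H)‖ = ‖T x + Complex.I • (x : H)‖ := by
  have h := symmetric_of_isSelfAdjoint hT x x
  have h0 : RCLike.re ⟪T x, Complex.I • (x : H)⟫_ℂ = 0 := by
    have h1 : (starRingEnd ℂ) ⟪T x, (x : H)⟫_ℂ = ⟪T x, (x : H)⟫_ℂ := by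
      rw [inner_conj_symm, h]
    have h2 := Complex.conj_eq_iff_im.mp h1
    simp [h2]
  have h3 := @norm_sub_sq ℂ H _ _ _ (T x) (Complex.I • (x : H))
  have h4 := @norm_add_sq ℂ H _ _ _ (T x) (Complex.I • (x : H))
  rw [h0] at h3 h4
  rw [← sq_eq_sq₀ (norm_nonneg _) (norm_nonneg _), h3, h4]
  ring

theorem existsUnique_cayley {T : H →ₗ.[ℂ] H} (hT : IsSelfAdjoint T) :
    ∃! U : H →L[ℂ] H, ∀ x : T.domain,
      U (T x + Complex.I • (x : H)) = T x - Complex.I • (x : H) := by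
  have hsurj := exists_add_smul_eq hT Complex.I_mul_I
  let S : T.domain →ₗ[ℂ] H := T.toFun + Complex.I • T.domain.subtype
  let D : T.domain →ₗ[ℂ] H := T.toFun - Complex.I • T.domain.subtype
  have hSD : ∀ x, ‖D x‖ = ‖S x‖ := fun x => norm_sub_I_eq hT x
  have hker : ∀ x : T.domain, S x = 0 → D x = 0 := fun x hx => by
    rw [← norm_eq_zero, hSD, hx, norm_zero]
  have hinj : Function.Injective S := by
    rw [injective_iff_map_eq_zero]
    intro x hx
    have h1 : T x + Complex.I • (x : H) = 0 := hx
    have h2 : T x - Complex.I • (x : H) = 0 := hker x hx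
    have h3 : (2 * Complex.I) • (x : H) = 0 := by
      have : (2 * Complex.I) • (x : H)
          = (T x + Complex.I • (x : H)) - (T x - Complex.I • (x : H)) := by module
      rw [this, h1, h2, sub_zero]
    exact Subtype.ext ((smul_eq_zero.mp h3).resolve_left (by simp))
  let e : T.domain ≃ₗ[ℂ] H := LinearEquiv.ofBijective S ⟨hinj, hsurj⟩
  let V : H →ₗᵢ[ℂ] H :=
    { toLinearMap := D ∘ₗ e.symm.toLinearMap
      norm_map' := fun y => by
        change ‖D (e.symm y)‖ = ‖y‖
        rw [hSD]
        exact congrArg norm (e.apply_symm_apply y) }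
  refine ⟨V.toContinuousLinearMap, fun x => ?_, fun U hU => ?_⟩
  · change D (e.symm (e x)) = D x
    rw [e.symm_apply_apply]
  · ext y
    obtain ⟨x, rfl⟩ := hsurj y
    rw [hU x]
    change D x = D (e.symm (e x))
    rw [e.symm_apply_apply]

/-- The Cayley transform `κ(T) = (T - i)(T + i)⁻¹` of a self-adjoint operator `T`. -/
def cayley (T : CFsa H) : H →L[ℂ] H :=
  (existsUnique_cayley T.isSelfAdjoint).choose

theorem cayley_apply (T : CFsa H) (x : T.op.domain) :
    cayley T (T.op x + Complex.I • (x : H)) = T.op x - Complex.I • (x : H) :=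
  (existsUnique_cayley T.isSelfAdjoint).choose_spec.1 x

theorem cayley_mem_unitary (T : CFsa H) : cayley T ∈ unitary (H →L[ℂ] H) := by
  have hn : ∀ y, ‖cayley T y‖ = ‖y‖ := fun y => by
    obtain ⟨x, rfl⟩ := exists_add_smul_eq T.isSelfAdjoint Complex.I_mul_I y
    rw [cayley_apply, norm_sub_I_eq T.isSelfAdjoint]
  have hs : Function.Surjective (cayley T) := fun y => by
    obtain ⟨x, rfl⟩ := exists_add_smul_eq T.isSelfAdjoint (c := -Complex.I) (by simp) y
    exact ⟨_, (cayley_apply T x).trans (by module)⟩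
  let e : H ≃ₗᵢ[ℂ] H := LinearIsometryEquiv.ofSurjective ⟨(cayley T : H →ₗ[ℂ] H), hn⟩ hs
  have he : ((Unitary.linearIsometryEquiv.symm e : unitary (H →L[ℂ] H)) : H →L[ℂ] H)
      = cayley T := by
    ext x
    rfl
  rw [← he]
  exact (Unitary.linearIsometryEquiv.symm e).2

instance (T : CFsa H) : IsStarNormal (cayley T) :=
  ⟨(Unitary.star_mul_self_of_mem (cayley_mem_unitary T)).trans
    (Unitary.mul_star_self_of_mem (cayley_mem_unitary T)).symm⟩

/-! ### Spectral projections -/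

/-- The continuous function `x ↦ max (0, 1 - dist (x, K) / δ)`, `δ = 1/(n+1)`; for `n → ∞` these
functions decrease to the indicator function of the closure of `K`. -/
def approxIndicator (K : Set ℂ) (n : ℕ) (z : ℂ) : ℂ :=
  ((thickenedIndicator (Nat.one_div_pos_of_nat (α := ℝ) (n := n)) K z : ℝ) : ℂ)

theorem continuous_approxIndicator (K : Set ℂ) (n : ℕ) : Continuous (approxIndicator K n) := by
  unfold approxIndicator
  fun_prop

/-- If `0 ≤ g ≤ 1` then `‖g(N) x‖² ≤ ⟨x, g(N) x⟩`. -/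
theorem norm_cfc_sq_le (N : H →L[ℂ] H) [IsStarNormal N] {g : ℂ → ℝ} (hg : Continuous g)
    (h0 : ∀ z, 0 ≤ g z) (h1 : ∀ z, g z ≤ 1) (x : H) :
    ‖cfc (fun z => (g z : ℂ)) N x‖ ^ 2 ≤ (⟪x, cfc (fun z => (g z : ℂ)) N x⟫_ℂ).re := by
  set B := cfc (fun z => (g z : ℂ)) N with hB
  set C := cfc (fun z => ((Real.sqrt (g z - g z ^ 2) : ℝ) : ℂ)) N with hC
  have hBs : star B = B := by
    rw [hB, ← cfc_star]
    simp
  have hCs : star C = C := by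
    rw [hC, ← cfc_star]
    simp
  have hgc : Continuous fun z => (g z : ℂ) := by fun_prop
  have hkc : Continuous fun z => ((Real.sqrt (g z - g z ^ 2) : ℝ) : ℂ) := by fun_prop
  have hg2 : Continuous fun z => (g z : ℂ) * (g z : ℂ) := hgc.mul hgc
  have hk2 : Continuous fun z => ((Real.sqrt (g z - g z ^ 2) : ℝ) : ℂ) *
      ((Real.sqrt (g z - g z ^ 2) : ℝ) : ℂ) := hkc.mul hkc
  have hsum : star C * C + star B * B = B := by
    rw [hBs, hCs, hB, hC, ← cfc_mul _ _ N hkc.continuousOn hkc.continuousOn,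
      ← cfc_mul _ _ N hgc.continuousOn hgc.continuousOn,
      ← cfc_add (a := N) _ _ hk2.continuousOn hg2.continuousOn]
    congr 1
    ext z
    rw [← Complex.ofReal_mul, Real.mul_self_sqrt (by nlinarith [h0 z, h1 z])]
    push_cast
    ring
  have key : ∀ A : H →L[ℂ] H, (⟪x, (star A * A) x⟫_ℂ).re = ‖A x‖ ^ 2 := fun A => by
    rw [ContinuousLinearMap.star_eq_adjoint, mul_apply_eq_comp,
      ContinuousLinearMap.adjoint_inner_right]
    exact inner_self_eq_norm_sq (𝕜 := ℂ) (A x)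
  have h := congrArg (fun A : H →L[ℂ] H => (⟪x, A x⟫_ℂ).re) hsum
  simp only [add_apply, inner_add_right, Complex.add_re, key] at h
  nlinarith [sq_nonneg ‖C x‖]

/-- Existence of the strong limit of the decreasing sequence `φ_n(N)`. -/
theorem exists_indicator (N : H →L[ℂ] H) [IsStarNormal N] (K : Set ℂ) :
    ∃ P : H →L[ℂ] H, ∀ x : H,
      Tendsto (fun n : ℕ => cfc (approxIndicator K n) N x) atTop (𝓝 (P x)) := by
  let g : ℕ → ℂ → ℝ := fun n z =>
    (thickenedIndicator (Nat.one_div_pos_of_nat (α := ℝ) (n := n)) K z : ℝ)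
  have hgc : ∀ n, Continuous (g n) := fun n => by fun_prop
  have hg0 : ∀ n z, 0 ≤ g n z := fun n z => NNReal.coe_nonneg _
  have hg1 : ∀ n z, g n z ≤ 1 := fun n z => by
    exact_mod_cast thickenedIndicator_le_one _ K z
  have hanti : ∀ m n, m ≤ n → ∀ z, g n z ≤ g m z := fun m n hmn z =>
    NNReal.coe_le_coe.mpr <| thickenedIndicator_mono Nat.one_div_pos_of_nat Nat.one_div_pos_of_nat
      (Nat.one_div_le_one_div hmn) K z
  have hdiff : ∀ m n, cfc (approxIndicator K m) N - cfc (approxIndicator K n) N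
      = cfc (fun z => ((g m z - g n z : ℝ) : ℂ)) N := fun m n => by
    rw [← cfc_sub _ _ N (continuous_approxIndicator K m).continuousOn
      (continuous_approxIndicator K n).continuousOn]
    congr 1
    ext z
    simp [approxIndicator, g]
  have hlim : ∀ x : H, ∃ y, Tendsto (fun n : ℕ => cfc (approxIndicator K n) N x) atTop (𝓝 y) := by
    intro x
    let a : ℕ → ℝ := fun n => (⟪x, cfc (approxIndicator K n) N x⟫_ℂ).re
    have hle : ∀ m n, m ≤ n →
        ‖cfc (approxIndicator K m) N x - cfc (approxIndicator K n) N x‖ ^ 2 ≤ a m - a n := by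
      intro m n hmn
      have h := norm_cfc_sq_le N (g := fun z => g m z - g n z) ((hgc m).sub (hgc n))
        (fun z => sub_nonneg.mpr (hanti m n hmn z))
        (fun z => by linarith [hg0 n z, hg1 m z]) x
      rw [← hdiff m n] at h
      simpa [a, inner_sub_right] using h
    have ha : Antitone a := fun m n hmn => by
      have := hle m n hmn
      nlinarith [sq_nonneg ‖cfc (approxIndicator K m) N x - cfc (approxIndicator K n) N x‖]
    have ha0 : ∀ n, 0 ≤ a n := fun n =>
      (sq_nonneg _).trans (norm_cfc_sq_le N (hgc n) (hg0 n) (hg1 n) x)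
    have hac : CauchySeq a :=
      (tendsto_atTop_ciInf ha ⟨0, by rintro _ ⟨n, rfl⟩; exact ha0 n⟩).cauchySeq
    refine cauchySeq_tendsto_of_complete (Metric.cauchySeq_iff'.mpr fun ε hε => ?_)
    obtain ⟨k, hk⟩ := Metric.cauchySeq_iff'.mp hac (ε ^ 2) (by positivity)
    refine ⟨k, fun n hn => ?_⟩
    have h1 := hle k n hn
    have h2 := hk n hn
    rw [Real.dist_eq, abs_lt] at h2
    rw [dist_comm, dist_eq_norm]
    exact lt_of_pow_lt_pow_left₀ 2 hε.le (by linarith)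
  choose P hP using hlim
  exact ⟨continuousLinearMapOfTendsto (fun n : ℕ => cfc (approxIndicator K n) N)
    (tendsto_pi_nhds.mpr hP), hP⟩

/-- The spectral projection `1_K(N)` of a bounded normal operator `N` and a closed set `K ⊆ ℂ`:
the strong limit of the operators `φ_n(N)` (continuous functional calculus), where the `φ_n` are
continuous and decrease pointwise to the indicator function of `K`. -/
def indicatorNormal (N : H →L[ℂ] H) [IsStarNormal N] (K : Set ℂ) : H →L[ℂ] H :=
  (exists_indicator N K).choose

/-- The spectral projection `1_{[a,b]}(T)` of a self-adjoint operator `T`, obtained from the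
Cayley transform: `1_{[a,b]}(T) = 1_{κ([a,b])}(κ(T))`, where `κ(x) = (x - i)/(x + i)`. -/
def spectralProjection (T : CFsa H) (a b : ℝ) : H →L[ℂ] H :=
  indicatorNormal (cayley T)
    ((fun x : ℝ => ((x : ℂ) - Complex.I) / ((x : ℂ) + Complex.I)) '' Set.Icc a b)

/-- For a finite-rank spectral projection `E` of `T`, the range of `E^≥`: the subspace of `E(H)`
spanned by those eigenvectors of `T` in `E(H)` which have non-negative eigenvalues. -/
def nonnegSubspace (T : CFsa H) (E : H →L[ℂ] H) : Submodule ℂ H :=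
  Submodule.span ℂ {v : H | v ∈ E.range ∧
    ∃ (x : T.op.domain) (μ : ℝ), (x : H) = v ∧ 0 ≤ μ ∧ T.op x = (μ : ℂ) • v}

/-! ### The choices entering the definition of spectral flow -/

/-- The choices for a path `f`: a partition `0 = t_0 < t_1 < ⋯ < t_n = 1` and positive numbers
`ε_1, …, ε_n` (the number `ε_{j+1}` is called `ε j`, for `j = 0, …, n - 1`) such that
`s ↦ 1_{[-ε_j, ε_j]}(f s)` is norm continuous and of finite rank on `[t_{j-1}, t_j]`. -/
structure FlowData (f : C(I, CFsa H)) where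
  n : ℕ
  t : Fin (n + 1) → I
  ε : Fin n → ℝ
  strictMono_t : StrictMono t
  t_zero : t 0 = 0
  t_last : t (Fin.last n) = 1
  ε_pos : ∀ j, 0 < ε j
  continuousOn : ∀ j : Fin n,
    ContinuousOn (fun s => spectralProjection (f s) (-ε j) (ε j))
      (Set.Icc (t j.castSucc) (t j.succ))
  finiteRank : ∀ j : Fin n, ∀ s ∈ Set.Icc (t j.castSucc) (t j.succ),
    FiniteDimensional ℂ (spectralProjection (f s) (-ε j) (ε j)).range

/-- `dim E_j^≥(s)`, where `E_j(s) = 1_{[-ε_j, ε_j]}(f s)`. -/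
def FlowData.dimNonneg {f : C(I, CFsa H)} (D : FlowData f) (j : Fin D.n) (s : I) : ℕ :=
  Module.finrank ℂ (nonnegSubspace (f s) (spectralProjection (f s) (-D.ε j) (D.ε j)))

/-- The spectral flow computed from the choices `D`:
`∑_j (dim E_j^≥(t_j) - dim E_j^≥(t_{j-1}))`. -/
def FlowData.spectralFlow {f : C(I, CFsa H)} (D : FlowData f) : ℤ :=
  ∑ j : Fin D.n, ((D.dimNonneg j (D.t j.succ) : ℤ) - (D.dimNonneg j (D.t j.castSucc) : ℤ))

end

end GapFlow

namespace GapFlow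

variable {H : Type*} [NormedAddCommGroup H] [InnerProductSpace ℂ H] [CompleteSpace H]

/-! ### Functional calculus and spectral projections of a normal operator -/

/-! The Cayley transform `κ(T)` is an affine continuous function of the graph projection, so it is
norm continuous for the gap metric, and so is `g(κ(T))` for each continuous `g`. The Fredholm
property says that `-1 = κ(0)` is at most an isolated point of the spectrum of `κ(T)`, with
finite-dimensional eigenspace.

Existence: near a given `T₀` some annulus around `-1` stays free of spectrum, so for a suitable `ε`
the projection `1_{[-ε, ε]}(T)` equals `g(κ(T))` with one continuous `g`; it is continuous and of
finite rank (`exists_nhds_continuousOn_spectralProjection`). Compactness of `[0, 1]` gives a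
partition.

Independence: let `ε ≤ ε'` both be admissible on an interval. The two values of `dim E^≥` differ by
the rank of the spectral projection for `(ε, ε']`. That projection varies continuously, so its rank
is constant, and both cut-offs give the same increment (`nonnegRank_sub_eq`). Two partitions are
then compared on the intersections of their intervals (`FlowData.sum_clamp`,
`nonnegRank_clamp_sub_eq`). -/

theorem adjoint_apply_eigenvector (N : H →L[ℂ] H) [hN : IsStarNormal N] {x : H} {z : ℂ}
    (hx : N x = z • x) : (star N) x = (starRingEnd ℂ z) • x := by
  -- A normal operator and its adjoint have the same kernel; this is applied to `N - z`.
  have hM : IsStarNormal (N - z • (1 : H →L[ℂ] H)) := by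
    refine ⟨?_⟩
    have h := hN.star_comm_self
    rw [commute_iff_eq] at h ⊢
    simp only [star_sub, star_smul, star_one, sub_mul, mul_sub, h, smul_mul_assoc, mul_smul_comm,
      one_mul, mul_one]
    rw [smul_sub, smul_sub, smul_comm z (star z)]
    abel
  have h := (ContinuousLinearMap.IsStarNormal.adjoint_apply_eq_zero_iff hM x).mpr (by simp [hx])
  rw [← ContinuousLinearMap.star_eq_adjoint] at h
  simpa [sub_eq_zero] using h

theorem mem_spectrum_of_eigenvector {H : Type*} [NormedAddCommGroup H] [InnerProductSpace ℂ H]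
    {N : H →L[ℂ] H} {x : H} {z : ℂ} (hx : N x = z • x)
    (h0 : x ≠ 0) : z ∈ spectrum ℂ N := by
  intro h
  obtain ⟨B, hB⟩ := h.exists_left_inv
  apply h0
  have := congrArg (fun A : H →L[ℂ] H => A x) hB
  simpa [Algebra.algebraMap_eq_smul_one, hx] using this.symm

/-- The continuous functional calculus acts on an eigenvector through the value of the function
at the eigenvalue. -/
theorem cfc_apply_eigenvector (N : H →L[ℂ] H) [hN : IsStarNormal N] {x : H} {z : ℂ}
    (hx : N x = z • x) {g : ℂ → ℂ} (hg : Continuous g) : cfc g N x = g z • x := by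
  rcases eq_or_ne x 0 with rfl | h0
  · simp
  have hz := mem_spectrum_of_eigenvector hx h0
  -- The functions with this property form a closed subalgebra containing the constants, the
  -- identity and its conjugate, so Stone–Weierstrass applies.
  have key : ∀ f : C(spectrum ℂ N, ℂ), cfcHom (R := ℂ) (a := N) hN f x = f ⟨z, hz⟩ • x := by
    intro f
    induction f using ContinuousMap.induction_on_of_compact with
    | const r =>
      have h1 : ContinuousMap.const (spectrum ℂ N) r = algebraMap ℂ C(spectrum ℂ N, ℂ) r := rfl
      rw [h1, AlgHomClass.commutes]
      simp [Algebra.algebraMap_eq_smul_one]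
    | id => rw [cfcHom_id]; simpa using hx
    | star_id =>
      rw [map_star, cfcHom_id]
      simpa using adjoint_apply_eigenvector N hx
    | add f g hf hg => simp [hf, hg, add_smul]
    | mul f g hf hg =>
      rw [map_mul, mul_apply_eq_comp, hg, map_smul, hf, smul_smul, ContinuousMap.mul_apply,
        mul_comm]
    | frequently f hf =>
      refine hf.mem_of_closed (s := {f | cfcHom (R := ℂ) (a := N) hN f x = f ⟨z, hz⟩ • x}) ?_
      have hc := cfcHom_continuous (R := ℂ) (a := N) hN
      exact isClosed_eq (by fun_prop) (by fun_prop)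
  rw [cfc_apply g N hN hg.continuousOn, key]
  rfl

theorem tendsto_indicatorNormal (N : H →L[ℂ] H) [IsStarNormal N] (K : Set ℂ) (x : H) :
    Tendsto (fun n : ℕ => cfc (approxIndicator K n) N x) atTop (𝓝 (indicatorNormal N K x)) :=
  (exists_indicator N K).choose_spec x

theorem approxIndicator_of_mem {K : Set ℂ} {z : ℂ} (hz : z ∈ K) (n : ℕ) :
    approxIndicator K n z = 1 := by
  simp [approxIndicator, thickenedIndicator_one _ K hz]

theorem approxIndicator_eq_zero {K : Set ℂ} {z : ℂ} {n : ℕ}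
    (hz : z ∉ Metric.thickening (1 / ((n : ℝ) + 1)) K) : approxIndicator K n z = 0 := by
  unfold approxIndicator
  rw [thickenedIndicator_zero _ K hz]
  simp

theorem norm_approxIndicator_le_one (K : Set ℂ) (n : ℕ) (z : ℂ) :
    ‖approxIndicator K n z‖ ≤ 1 := by
  unfold approxIndicator
  rw [Complex.norm_real, Real.norm_of_nonneg (NNReal.coe_nonneg _)]
  exact_mod_cast thickenedIndicator_le_one _ K z

theorem norm_approxIndicator_sub_le (K : Set ℂ) (n : ℕ) (z w : ℂ) :
    ‖approxIndicator K n z - approxIndicator K n w‖ ≤ ((n : ℝ) + 1) * dist z w := by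
  have h := (lipschitzWith_thickenedIndicator
    (Nat.one_div_pos_of_nat (α := ℝ) (n := n)) K).dist_le_mul z w
  rw [NNReal.dist_eq] at h
  unfold approxIndicator
  rw [← Complex.ofReal_sub, Complex.norm_real, Real.norm_eq_abs]
  refine h.trans_eq ?_
  rw [NNReal.coe_inv, Real.coe_toNNReal _ (Nat.one_div_pos_of_nat).le]
  simp

/-- Where `φ_n` does not vanish, `z` is within `1/(n+1)` of `K`, where `φ_m = 1`; the Lipschitz
constant of `φ_m` is `m + 1`. For fixed `m` the bound tends to `0` as `n → ∞`. -/
theorem norm_approxIndicator_mul_sub_le (K : Set ℂ) (m n : ℕ) (z : ℂ) :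
    ‖approxIndicator K m z * approxIndicator K n z - approxIndicator K n z‖
      ≤ ((m : ℝ) + 1) * (1 / ((n : ℝ) + 1)) := by
  by_cases hz : z ∈ Metric.thickening (1 / ((n : ℝ) + 1)) K
  · obtain ⟨w, hw, hd⟩ := Metric.mem_thickening_iff.mp hz
    have h1 := norm_approxIndicator_sub_le K m z w
    rw [approxIndicator_of_mem hw] at h1
    have h2 := norm_approxIndicator_le_one K n z
    calc _ = ‖approxIndicator K m z - 1‖ * ‖approxIndicator K n z‖ := by
          rw [← norm_mul]; congr 1; ring
      _ ≤ ‖approxIndicator K m z - 1‖ := mul_le_of_le_one_right (norm_nonneg _) h2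
      _ ≤ _ := h1.trans (by gcongr)
  · rw [approxIndicator_eq_zero hz]
    simp
    positivity

/-- `φ_m(N) φ_n(N) - φ_n(N)` tends to `0` in norm as `n → ∞`. Idempotence of the spectral projection
follows on letting `m → ∞`. -/
theorem cfc_approxIndicator_indicatorNormal (N : H →L[ℂ] H) [IsStarNormal N] (K : Set ℂ) (m : ℕ)
    (x : H) : cfc (approxIndicator K m) N (indicatorNormal N K x) = indicatorNormal N K x := by
  have h1 : Tendsto (fun n : ℕ => cfc (approxIndicator K m) N (cfc (approxIndicator K n) N x)
      - cfc (approxIndicator K n) N x) atTop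
      (𝓝 (cfc (approxIndicator K m) N (indicatorNormal N K x) - indicatorNormal N K x)) :=
    (((cfc (approxIndicator K m) N).continuous.tendsto _).comp
      (tendsto_indicatorNormal N K x)).sub (tendsto_indicatorNormal N K x)
  have h2 : Tendsto (fun n : ℕ => cfc (approxIndicator K m) N (cfc (approxIndicator K n) N x)
      - cfc (approxIndicator K n) N x) atTop (𝓝 0) := by
    have h3 : Tendsto (fun n : ℕ => ((m : ℝ) + 1) * (1 / ((n : ℝ) + 1)) * ‖x‖) atTop (𝓝 0) := by
      simpa using (tendsto_one_div_add_atTop_nhds_zero_nat.const_mul ((m : ℝ) + 1)).mul_const ‖x‖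
    refine squeeze_zero_norm (fun n => ?_) h3
    have h4 : cfc (approxIndicator K m) N (cfc (approxIndicator K n) N x)
        - cfc (approxIndicator K n) N x
        = cfc (fun z => approxIndicator K m z * approxIndicator K n z - approxIndicator K n z) N
          x := by
      have hm := (continuous_approxIndicator K m)
      have hn := (continuous_approxIndicator K n)
      rw [cfc_sub (a := N) (fun z => approxIndicator K m z * approxIndicator K n z) _
        (hm.mul hn).continuousOn hn.continuousOn,
        cfc_mul _ _ N hm.continuousOn hn.continuousOn]
      rfl
    rw [h4]
    refine (ContinuousLinearMap.le_opNorm _ _).trans ?_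
    gcongr
    exact norm_cfc_le (by positivity) fun z _ => norm_approxIndicator_mul_sub_le K m n z
  exact sub_eq_zero.mp (tendsto_nhds_unique h1 h2)

theorem indicatorNormal_idem (N : H →L[ℂ] H) [IsStarNormal N] (K : Set ℂ) (x : H) :
    indicatorNormal N K (indicatorNormal N K x) = indicatorNormal N K x :=
  tendsto_nhds_unique (tendsto_indicatorNormal N K _)
    (by simp only [cfc_approxIndicator_indicatorNormal]; exact tendsto_const_nhds)

theorem indicatorNormal_apply_of_mem_range (N : H →L[ℂ] H) [IsStarNormal N] (K : Set ℂ) {v : H}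
    (hv : v ∈ (indicatorNormal N K).range) : indicatorNormal N K v = v := by
  obtain ⟨x, rfl⟩ := hv
  exact indicatorNormal_idem N K x

theorem indicatorNormal_apply_comm (N : H →L[ℂ] H) [hN : IsStarNormal N] (K : Set ℂ) (x : H) :
    indicatorNormal N K (N x) = N (indicatorNormal N K x) := by
  refine tendsto_nhds_unique (tendsto_indicatorNormal N K (N x)) ?_
  have h := (N.continuous.tendsto _).comp (tendsto_indicatorNormal N K x)
  refine h.congr fun n => ?_
  have hc : Commute (cfc (approxIndicator K n) N) N :=
    (Commute.refl N).cfc hN.star_comm_self _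
  exact congrArg (fun A : H →L[ℂ] H => A x) hc.eq.symm

theorem indicatorNormal_apply_eigenvector (N : H →L[ℂ] H) [IsStarNormal N] {K : Set ℂ} {x : H}
    {z : ℂ} (hx : N x = z • x) (hz : z ∈ K) : indicatorNormal N K x = x := by
  refine tendsto_nhds_unique (tendsto_indicatorNormal N K x) ?_
  simp only [cfc_apply_eigenvector N hx (continuous_approxIndicator K _),
    approxIndicator_of_mem hz, one_smul]
  exact tendsto_const_nhds

theorem indicatorNormal_apply_eigenvector_of_notMem (N : H →L[ℂ] H) [IsStarNormal N] {K : Set ℂ}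
    (hK : IsClosed K) {x : H} {z : ℂ} (hx : N x = z • x) (hz : z ∉ K) :
    indicatorNormal N K x = 0 := by
  refine tendsto_nhds_unique (tendsto_indicatorNormal N K x) ?_
  -- A closed set is the intersection of its thickenings, so `φ_n(z) = 0` for all large `n`.
  rw [← hK.closure_eq, Metric.closure_eq_iInter_thickening] at hz
  simp only [Set.mem_iInter, not_forall] at hz
  obtain ⟨δ, hδ, hz⟩ := hz
  have h1 : ∀ᶠ n : ℕ in atTop, 1 / ((n : ℝ) + 1) < δ :=
    tendsto_one_div_add_atTop_nhds_zero_nat.eventually (gt_mem_nhds hδ)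
  refine tendsto_const_nhds.congr' ?_
  filter_upwards [h1] with n hn
  rw [cfc_apply_eigenvector N hx (continuous_approxIndicator K _), approxIndicator_eq_zero,
    zero_smul]
  exact fun h => hz (Metric.thickening_mono hn.le K h)

/-- If `g` is the indicator function of `K` on the spectrum of `N`, and the rest of the spectrum
has positive distance from `K`, then the spectral projection is `g(N)`. -/
theorem indicatorNormal_eq_cfc (N : H →L[ℂ] H) [IsStarNormal N] {K : Set ℂ} {g : ℂ → ℂ}
    {δ : ℝ} (hδ : 0 < δ) (h1 : ∀ z ∈ spectrum ℂ N, z ∈ K → g z = 1)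
    (h0 : ∀ z ∈ spectrum ℂ N, z ∉ K → g z = 0 ∧ z ∉ Metric.thickening δ K) :
    indicatorNormal N K = cfc g N := by
  ext x
  refine tendsto_nhds_unique (tendsto_indicatorNormal N K x) ?_
  have h2 : ∀ᶠ n : ℕ in atTop, 1 / ((n : ℝ) + 1) < δ :=
    tendsto_one_div_add_atTop_nhds_zero_nat.eventually (gt_mem_nhds hδ)
  refine tendsto_const_nhds.congr' ?_
  filter_upwards [h2] with n hn
  congr 1
  refine cfc_congr fun z hz => ?_
  by_cases hzK : z ∈ K
  · rw [h1 z hz hzK, approxIndicator_of_mem hzK]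
  · rw [(h0 z hz hzK).1, approxIndicator_eq_zero]
    exact fun h => (h0 z hz hzK).2 (Metric.thickening_mono hn.le K h)

/-- If `W = N + 1` satisfies `‖W x‖ ≤ C ‖W (W x)‖` for all `x`, then the spectrum of `N` has no
points at distance less than `1 / C` from `-1`, except perhaps `-1` itself. -/
theorem eq_neg_one_of_mem_spectrum (N : H →L[ℂ] H) [IsStarNormal N] {C : ℝ} (hC : 0 < C)
    (h : ∀ x, ‖(N + 1) x‖ ≤ C * ‖(N + 1) ((N + 1) x)‖) {z : ℂ} (hz : z ∈ spectrum ℂ N)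
    (hz1 : ‖z + 1‖ < 1 / C) : z = -1 := by
  by_contra hne
  have hpos : 0 < ‖z + 1‖ := norm_pos_iff.mpr fun h => hne (eq_neg_of_add_eq_zero_left h)
  obtain ⟨ρ, hρ1, hρ2⟩ := exists_between hz1
  have hρ0 : 0 < ρ := hpos.trans hρ1
  -- The factor `w + 1` puts the range of `k(N)` into that of `N + 1`, where the lower bound holds;
  -- the other factor restricts the support to `‖w + 1‖ ≤ ρ`. Hence `‖k(N)‖ ≤ C ρ ‖k(N)‖` with `C ρ
  -- < 1`, while `k z ≠ 0`.
  set k : ℂ → ℂ := fun w => (w + 1) * ((max 0 (ρ - ‖w + 1‖) : ℝ) : ℂ) with hk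
  have hkc : Continuous k := by fun_prop
  have hid : Continuous fun w : ℂ => w + 1 := by fun_prop
  have hmc : Continuous fun w : ℂ => ((max 0 (ρ - ‖w + 1‖) : ℝ) : ℂ) := by fun_prop
  have hW : cfc (fun w : ℂ => w + 1) N = N + 1 := by
    rw [cfc_add_const (1 : ℂ) (fun w : ℂ => w) N, cfc_id' ℂ N]
    simp
  have e1 : cfc k N = (N + 1) * cfc (fun w : ℂ => ((max 0 (ρ - ‖w + 1‖) : ℝ) : ℂ)) N := by
    rw [hk, cfc_mul _ _ N hid.continuousOn hmc.continuousOn, hW]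
  have e2 : cfc (fun w => (w + 1) * k w) N = (N + 1) * cfc k N := by
    rw [cfc_mul _ _ N hid.continuousOn hkc.continuousOn, hW]
  have b1 : ‖cfc k N‖ ≤ C * ‖(N + 1) * cfc k N‖ := by
    refine ContinuousLinearMap.opNorm_le_bound _ (by positivity) fun x => ?_
    have h1 := h (cfc (fun w : ℂ => ((max 0 (ρ - ‖w + 1‖) : ℝ) : ℂ)) N x)
    have h2 : cfc k N x = (N + 1) (cfc (fun w : ℂ => ((max 0 (ρ - ‖w + 1‖) : ℝ) : ℂ)) N x) := by
      rw [e1]; rfl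
    rw [← h2] at h1
    refine h1.trans ?_
    rw [mul_assoc]
    gcongr
    exact ((N + 1) * cfc k N).le_opNorm x
  have b2 : ‖(N + 1) * cfc k N‖ ≤ ρ * ‖cfc k N‖ := by
    rw [← e2]
    refine norm_cfc_le (by positivity) fun w hw => ?_
    have h1 := norm_apply_le_norm_cfc k N hw hkc.continuousOn
    rw [norm_mul]
    rcases le_total ‖w + 1‖ ρ with h2 | h2
    · gcongr
    · have : k w = 0 := by
        simp only [hk]
        rw [max_eq_left (by linarith)]
        simp
      rw [this]
      simp
      positivity
  have b3 : 0 < ‖cfc k N‖ := by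
    refine lt_of_lt_of_le ?_ (norm_apply_le_norm_cfc k N hz hkc.continuousOn)
    rw [norm_pos_iff, hk]
    refine mul_ne_zero (norm_pos_iff.mp hpos) ?_
    rw [max_eq_right (by linarith)]
    exact_mod_cast (sub_pos.mpr hρ1).ne'
  have b4 : C * ρ < 1 := by rwa [lt_div_iff₀ hC, mul_comm] at hρ2
  nlinarith [mul_le_mul_of_nonneg_left b2 hC.le]

/-! ### The Cayley transform as a function of the operator -/

/-- If `(x, Tx)` is the projection of `(y, 0)`, orthogonality to the graph says `T(Tx) = y - x`,
that is `x = (1 + T²)⁻¹ y`. The formula is then `(T - i)²(1 + T²)⁻¹ = 1 - 2(1 + T²)⁻¹ - 2i T(1 +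
T²)⁻¹`. -/
theorem cayley_eq_graphProjection (T : CFsa H) (y : H) :
    cayley T y = y - (2 : ℂ) • (graphProjection T (WithLp.toLp 2 (y, 0))).fst
      - (2 * Complex.I) • (graphProjection T (WithLp.toLp 2 (y, 0))).snd := by
  have hT := T.isSelfAdjoint
  have : CompleteSpace (graphSubspace T.op) := (isClosed_graphSubspace hT).completeSpace_coe
  set v : WithLp 2 (H × H) := WithLp.toLp 2 (y, (0 : H)) with hv
  have h1 : graphProjection T v ∈ graphSubspace T.op := Submodule.starProjection_apply_mem _ _
  have h2 : v - graphProjection T v ∈ (graphSubspace T.op)ᗮ :=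
    Submodule.sub_starProjection_mem_orthogonal _
  generalize graphProjection T v = p at h1 h2 ⊢
  rw [mem_graphSubspace_iff, LinearPMap.mem_graph_iff] at h1
  obtain ⟨x, hx1, hx2⟩ := h1
  simp only at hx1 hx2
  have h3 : ∀ w : T.op.domain, ⟪y - x, (w : H)⟫_ℂ = ⟪T.op x, T.op w⟫_ℂ := by
    intro w
    have hw : WithLp.toLp 2 ((w : H), T.op w) ∈ graphSubspace T.op := LinearPMap.mem_graph T.op w
    have h4 := (Submodule.mem_orthogonal' _ _).mp h2 _ hw
    rw [WithLp.prod_inner_apply] at h4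
    simp only [WithLp.ofLp_sub, Prod.fst_sub, Prod.snd_sub, inner_sub_left, hv] at h4
    change ⟪y, (w : H)⟫_ℂ - ⟪p.fst, (w : H)⟫_ℂ + (⟪(0 : H), T.op w⟫_ℂ - ⟪p.snd, T.op w⟫_ℂ) = 0
      at h4
    rw [← hx1, ← hx2, inner_zero_left] at h4
    rw [inner_sub_left]
    linear_combination h4
  have hd : T.op x ∈ T.op.adjoint.domain := LinearPMap.mem_adjoint_domain_of_exists _ ⟨_, h3⟩
  have ha : T.op.adjoint ⟨T.op x, hd⟩ = y - x := LinearPMap.adjoint_apply_eq hT.dense_domain _ h3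
  have hg : (T.op x, y - (x : H)) ∈ T.op.adjoint.graph :=
    (LinearPMap.mem_graph_iff _).mpr ⟨⟨_, hd⟩, rfl, ha⟩
  rw [LinearPMap.isSelfAdjoint_def.mp hT] at hg
  obtain ⟨b, hb1, hb2⟩ := (LinearPMap.mem_graph_iff _).mp hg
  simp only at hb1 hb2
  -- With `b = Tx`, the vector `b - i x` satisfies `(T + i)(b - i x) = T²x + x = y`.
  have h5 := cayley_apply T (b - Complex.I • x)
  rw [LinearPMap.map_sub, LinearPMap.map_smul, hb2] at h5
  push_cast at h5
  rw [hb1, smul_sub, smul_smul, Complex.I_mul_I] at h5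
  have h6 : y - (x : H) - Complex.I • T.op x + (Complex.I • T.op x - (-1 : ℂ) • (x : H)) = y := by
    module
  rw [h6] at h5
  rw [h5, ← hx1, ← hx2]
  module

theorem continuous_graphProjection :
    Continuous (graphProjection : CFsa H → WithLp 2 (H × H) →L[ℂ] WithLp 2 (H × H)) :=
  (Isometry.of_dist_eq fun S T => ((dist_eq S T).trans (dist_eq_norm _ _).symm).symm).continuous

theorem continuous_cayley : Continuous (cayley : CFsa H → H →L[ℂ] H) := by
  let J : H →L[ℂ] WithLp 2 (H × H) :=
    (WithLp.prodContinuousLinearEquiv 2 ℂ H H).symm.toContinuousLinearMap.comp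
      (ContinuousLinearMap.inl ℂ H H)
  have h : (cayley : CFsa H → H →L[ℂ] H) = fun T => 1
      - (2 : ℂ) • ((WithLp.fstL 2 ℂ H H).comp ((graphProjection T).comp J))
      - (2 * Complex.I) • ((WithLp.sndL 2 ℂ H H).comp ((graphProjection T).comp J)) := by
    ext T y
    rw [cayley_eq_graphProjection]
    rfl
  rw [h]
  have hc : Continuous fun T : CFsa H => (graphProjection T).comp J :=
    continuous_graphProjection.clm_comp continuous_const
  have h1 := (continuous_const (y := WithLp.fstL 2 ℂ H H)).clm_comp hc
  have h2 := (continuous_const (y := WithLp.sndL 2 ℂ H H)).clm_comp hc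
  exact (continuous_const.sub (h1.const_smul (2 : ℂ))).sub (h2.const_smul (2 * Complex.I))

theorem norm_eq_one_of_mem_spectrum_cayley (T : CFsa H) {z : ℂ}
    (hz : z ∈ spectrum ℂ (cayley T)) : ‖z‖ = 1 :=
  spectrum.norm_eq_one_of_unitary (cayley_mem_unitary T) hz

theorem continuous_cfc_cayley {g : ℂ → ℂ} (hg : Continuous g) :
    Continuous fun T : CFsa H => cfc g (cayley T) := by
  -- All the spectra lie in one compact set, the unit circle.
  refine Continuous.cfc' (isCompact_sphere (0 : ℂ) 1) g continuous_cayley (fun T z hz => ?_)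
    hg.continuousOn fun T => inferInstance
  simpa using norm_eq_one_of_mem_spectrum_cayley T hz

/-- The Cayley transform `x ↦ (x - i) / (x + i)` on the real line. -/
noncomputable def cayleyPoint (x : ℝ) : ℂ := ((x : ℂ) - Complex.I) / ((x : ℂ) + Complex.I)

theorem ofReal_add_I_ne_zero (x : ℝ) : (x : ℂ) + Complex.I ≠ 0 := fun h => by
  simpa using congrArg Complex.im h

theorem continuous_cayleyPoint : Continuous cayleyPoint :=
  Continuous.div (by fun_prop) (by fun_prop) ofReal_add_I_ne_zero

theorem cayleyPoint_injective : Function.Injective cayleyPoint := by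
  intro x y h
  unfold cayleyPoint at h
  rw [div_eq_div_iff (ofReal_add_I_ne_zero x) (ofReal_add_I_ne_zero y)] at h
  have := congrArg Complex.im h
  simp at this
  linarith

theorem isClosed_cayleyPoint_image (a b : ℝ) : IsClosed (cayleyPoint '' Set.Icc a b) :=
  (isCompact_Icc.image continuous_cayleyPoint).isClosed

theorem norm_cayleyPoint_add_one_sq (x : ℝ) :
    ‖cayleyPoint x + 1‖ ^ 2 = 4 * x ^ 2 / (x ^ 2 + 1) := by
  have h : cayleyPoint x + 1 = (2 * x : ℝ) / ((x : ℂ) + Complex.I) := by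
    unfold cayleyPoint
    field_simp [ofReal_add_I_ne_zero x]
    push_cast
    ring
  rw [h, norm_div, div_pow, Complex.norm_real, Real.norm_eq_abs, sq_abs, ← Complex.normSq_eq_norm_sq,
    Complex.normSq_apply]
  simp
  ring

theorem eq_cayleyPoint_of_norm_eq_one {z : ℂ} (hz : ‖z‖ = 1) (h1 : z ≠ 1) :
    ∃ x : ℝ, cayleyPoint x = z := by
  have hz' : z.re * z.re + z.im * z.im = 1 := by
    rw [← Complex.normSq_apply, Complex.normSq_eq_norm_sq, hz, one_pow]
  have hre : 1 - z.re ≠ 0 := fun h => h1 (Complex.ext (by simp; linarith) (by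
    have : z.re = 1 := by linarith
    simp; nlinarith))
  -- The inverse Cayley transform `i(1 + z)/(1 - z)` on the unit circle.
  obtain ⟨x, hx⟩ : ∃ x : ℝ, x * (1 - z.re) = -z.im := ⟨-z.im / (1 - z.re), by field_simp⟩
  refine ⟨x, ?_⟩
  unfold cayleyPoint
  rw [div_eq_iff (ofReal_add_I_ne_zero _)]
  apply Complex.ext
  · simp
    linear_combination hx
  · simp
    refine mul_right_cancel₀ hre ?_
    linear_combination hz' - z.im * hx

/-- The arc of the unit circle onto which `[-ε, ε]` is mapped, described through the distance
from `-1`. -/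
theorem mem_cayleyPoint_image_iff {ε : ℝ} (hε : 0 < ε) {z : ℂ} :
    z ∈ cayleyPoint '' Set.Icc (-ε) ε ↔ ‖z‖ = 1 ∧ ‖z + 1‖ ≤ 2 * ε / √(ε ^ 2 + 1) := by
  have hmono : ∀ x : ℝ, ‖cayleyPoint x + 1‖ ≤ 2 * ε / √(ε ^ 2 + 1) ↔ |x| ≤ ε := by
    intro x
    have e : (2 * ε / √(ε ^ 2 + 1)) ^ 2 = 4 * ε ^ 2 / (ε ^ 2 + 1) := by
      rw [div_pow, Real.sq_sqrt (by positivity)]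
      ring
    rw [← sq_le_sq₀ (norm_nonneg _) (by positivity), norm_cayleyPoint_add_one_sq, e,
      div_le_div_iff₀ (by positivity) (by positivity), ← sq_le_sq₀ (abs_nonneg x) hε.le, sq_abs]
    constructor <;> intro h <;> nlinarith
  constructor
  · rintro ⟨x, hx, rfl⟩
    refine ⟨?_, (hmono x).mpr (abs_le.mpr hx)⟩
    unfold cayleyPoint
    rw [norm_div, div_eq_one_iff_eq (norm_ne_zero_iff.mpr (ofReal_add_I_ne_zero x)),
      ← sq_eq_sq₀ (norm_nonneg _) (norm_nonneg _), ← Complex.normSq_eq_norm_sq,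
      ← Complex.normSq_eq_norm_sq, Complex.normSq_apply, Complex.normSq_apply]
    simp
  · rintro ⟨h1, h2⟩
    -- The point `1`, the image of infinity, has distance `2` from `-1`, but `2ε/√(ε² + 1) < 2`.
    have hne : z ≠ 1 := by
      rintro rfl
      have h3 : (2 : ℝ) ≤ 2 * ε / √(ε ^ 2 + 1) := by
        refine le_trans (le_of_eq ?_) h2
        norm_num
      rw [le_div_iff₀ (by positivity)] at h3
      have h4 : √(ε ^ 2 + 1) ≤ ε := by linarith
      have h5 : ε < √(ε ^ 2 + 1) := Real.lt_sqrt_of_sq_lt (by linarith)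
      linarith
    obtain ⟨x, rfl⟩ := eq_cayleyPoint_of_norm_eq_one h1 hne
    exact ⟨x, abs_le.mp ((hmono x).mp h2), rfl⟩

theorem cayley_apply_eigenvector (T : CFsa H) {x : T.op.domain} {μ : ℝ}
    (hx : T.op x = (μ : ℂ) • (x : H)) : cayley T (x : H) = cayleyPoint μ • (x : H) := by
  have h := cayley_apply T x
  rw [hx, ← add_smul, ← sub_smul, map_smul] at h
  unfold cayleyPoint
  rw [div_eq_inv_mul, mul_smul, ← h, smul_smul, inv_mul_cancel₀ (ofReal_add_I_ne_zero μ), one_smul]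

/-! ### Consequences of the Fredholm property -/

/-- From `(κ(T) + 1)(T + i)x = 2Tx` and the surjectivity of `T + i`. The same identity controls the
kernel. -/
theorem range_cayley_add_one (T : CFsa H) :
    ((cayley T + 1 : H →L[ℂ] H).range : Set H) = LinearMap.range T.op.toFun := by
  ext y
  constructor
  · rintro ⟨z, rfl⟩
    obtain ⟨x, rfl⟩ := exists_add_smul_eq T.isSelfAdjoint Complex.I_mul_I z
    refine ⟨(2 : ℂ) • x, ?_⟩
    change T.op ((2 : ℂ) • x) = cayley T (T.op x + Complex.I • (x : H))
      + (T.op x + Complex.I • (x : H))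
    rw [cayley_apply, LinearPMap.map_smul]
    module
  · rintro ⟨x, rfl⟩
    refine ⟨(2⁻¹ : ℂ) • (T.op x + Complex.I • (x : H)), ?_⟩
    change cayley T ((2⁻¹ : ℂ) • (T.op x + Complex.I • (x : H)))
      + (2⁻¹ : ℂ) • (T.op x + Complex.I • (x : H)) = T.op x
    rw [map_smul, cayley_apply]
    module

theorem ker_cayley_add_one_le (T : CFsa H) :
    (cayley T + 1 : H →L[ℂ] H).ker ≤ (LinearMap.ker T.op.toFun).map T.op.domain.subtype := by
  intro z hz
  obtain ⟨x, rfl⟩ := exists_add_smul_eq T.isSelfAdjoint Complex.I_mul_I z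
  have h1 : cayley T (T.op x + Complex.I • (x : H)) + (T.op x + Complex.I • (x : H)) = 0 := hz
  rw [cayley_apply] at h1
  have h2 : T.op x = 0 := by
    have h3 : (2 : ℂ) • T.op x = 0 := by rw [← h1]; module
    simpa using h3
  refine ⟨Complex.I • x, ?_, ?_⟩
  · change T.op (Complex.I • x) = 0
    rw [LinearPMap.map_smul, h2, smul_zero]
  · rw [h2, zero_add]
    rfl

theorem finiteDimensional_ker_cayley_add_one (T : CFsa H) :
    FiniteDimensional ℂ (cayley T + 1 : H →L[ℂ] H).ker := by
  have := T.isFredholm.finiteDimensional_ker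
  exact Submodule.finiteDimensional_of_le (ker_cayley_add_one_le T)

/-- A normal operator with closed range is bounded below on its range. -/
theorem exists_norm_apply_le_of_isClosed_range (W : H →L[ℂ] H) (hW : IsStarNormal W)
    (hr : IsClosed (W.range : Set H)) : ∃ C > 0, ∀ x, ‖W x‖ ≤ C * ‖W (W x)‖ := by
  have : CompleteSpace W.range := hr.completeSpace_coe
  have hs : Function.Surjective W.rangeRestrict := fun ⟨y, x, hx⟩ => ⟨x, Subtype.ext hx⟩
  obtain ⟨C, hC, h⟩ := W.rangeRestrict.exists_preimage_norm_le hs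
  refine ⟨C, hC, fun u => ?_⟩
  set v := W u with hv
  obtain ⟨x, hx1, hx2⟩ := h (W.rangeRestrict v)
  have hx1' : W x = W v := congrArg Subtype.val hx1
  have hx2' : ‖x‖ ≤ C * ‖W v‖ := hx2
  -- Normality makes the kernel of `W` the orthogonal complement of its range. So `v` is the
  -- component of `x` in the range, and `‖v‖ ≤ ‖x‖`; the constant `C` comes from the open mapping
  -- theorem.
  have hk : v - x ∈ W.rangeᗮ := by
    rw [ContinuousLinearMap.IsStarNormal.orthogonal_range hW]
    change W (v - x) = 0
    rw [map_sub, hx1', sub_self]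
  have h0 : ⟪v, v - x⟫_ℂ = 0 := (Submodule.mem_orthogonal _ _).mp hk v ⟨u, rfl⟩
  rw [inner_sub_right, sub_eq_zero] at h0
  have h1 : ‖v‖ ^ 2 ≤ ‖v‖ * ‖x‖ := by
    rw [← inner_self_eq_norm_sq (𝕜 := ℂ), h0]
    exact (RCLike.re_le_norm _).trans (norm_inner_le_norm _ _)
  refine le_trans ?_ hx2'
  rcases (norm_nonneg v).eq_or_lt with h2 | h2
  · rw [← h2]; positivity
  · nlinarith

theorem exists_gap_spectrum_cayley (T : CFsa H) :
    ∃ c > 0, ∀ z ∈ spectrum ℂ (cayley T), ‖z + 1‖ < c → z = -1 := by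
  have hn : IsStarNormal (cayley T + 1) := by
    refine ⟨?_⟩
    have h := (inferInstance : IsStarNormal (cayley T)).star_comm_self
    simp only [star_add, star_one]
    exact (h.add_right (Commute.one_right _)).add_left (Commute.one_left _)
  have hr : IsClosed ((cayley T + 1 : H →L[ℂ] H).range : Set H) := by
    rw [range_cayley_add_one]
    exact T.isFredholm.isClosed_range
  obtain ⟨C, hC, h⟩ := exists_norm_apply_le_of_isClosed_range _ hn hr
  exact ⟨1 / C, by positivity, fun z hz hz1 => eq_neg_one_of_mem_spectrum _ hC h hz hz1⟩

/-! ### Spectral projections of finite rank -/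

/-- The span of the eigenvectors of `T` with eigenvalues in `S`. -/
def eigenSpan (T : CFsa H) (S : Set ℝ) : Submodule ℂ H :=
  Submodule.span ℂ {v : H | ∃ (x : T.op.domain) (μ : ℝ),
    (x : H) = v ∧ μ ∈ S ∧ T.op x = (μ : ℂ) • v}

theorem eigenSpan_mono (T : CFsa H) {S S' : Set ℝ} (h : S ⊆ S') :
    eigenSpan T S ≤ eigenSpan T S' :=
  Submodule.span_mono fun _ ⟨x, μ, hx, hμ, hT⟩ => ⟨x, μ, hx, h hμ, hT⟩

theorem spectralProjection_apply_eigenvector (T : CFsa H) {a b : ℝ} {x : T.op.domain} {μ : ℝ}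
    (hx : T.op x = (μ : ℂ) • (x : H)) (hμ : μ ∈ Set.Icc a b) :
    spectralProjection T a b (x : H) = x :=
  indicatorNormal_apply_eigenvector _ (cayley_apply_eigenvector T hx) ⟨μ, hμ, rfl⟩

theorem spectralProjection_apply_eigenvector_of_notMem (T : CFsa H) {a b : ℝ} {x : T.op.domain}
    {μ : ℝ} (hx : T.op x = (μ : ℂ) • (x : H)) (hμ : μ ∉ Set.Icc a b) :
    spectralProjection T a b (x : H) = 0 := by
  refine indicatorNormal_apply_eigenvector_of_notMem _ (isClosed_cayleyPoint_image a b)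
    (cayley_apply_eigenvector T hx) ?_
  rintro ⟨ν, hν, h⟩
  exact hμ (cayleyPoint_injective h ▸ hν)

theorem spectralProjection_apply_of_mem_range (T : CFsa H) {a b : ℝ} {v : H}
    (hv : v ∈ (spectralProjection T a b).range) : spectralProjection T a b v = v :=
  indicatorNormal_apply_of_mem_range _ _ hv

theorem mem_Icc_of_eigenvector_mem_range (T : CFsa H) {a b : ℝ} {x : T.op.domain} {μ : ℝ}
    (hx : T.op x = (μ : ℂ) • (x : H)) (h0 : (x : H) ≠ 0)
    (hr : (x : H) ∈ (spectralProjection T a b).range) : μ ∈ Set.Icc a b := by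
  by_contra hμ
  apply h0
  rw [← spectralProjection_apply_of_mem_range T hr,
    spectralProjection_apply_eigenvector_of_notMem T hx hμ]

/-- A finite-dimensional subspace invariant under the Cayley transform is contained in the domain
and invariant under the operator. -/
theorem exists_domain_of_invariant (T : CFsa H) (F : Submodule ℂ H) [FiniteDimensional ℂ F]
    (hF : ∀ v ∈ F, cayley T v ∈ F) {v : H} (hv : v ∈ F) :
    ∃ x : T.op.domain, (x : H) = v ∧ T.op x ∈ F := by
  -- Since `(1 - κ(T))(T + i)x = 2i x`, the operator `1 - κ(T)` is injective with range in the
  -- domain of `T`; on the finite-dimensional `F` it is therefore onto.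
  let A : F →ₗ[ℂ] F := (1 - cayley T : H →L[ℂ] H).toLinearMap.restrict (p := F) (q := F)
    fun w hw => F.sub_mem hw (hF w hw)
  have hA : Function.Injective A := by
    rw [injective_iff_map_eq_zero]
    rintro ⟨w, hw⟩ h
    have h1 : w - cayley T w = 0 := congrArg Subtype.val h
    obtain ⟨x, rfl⟩ := exists_add_smul_eq T.isSelfAdjoint Complex.I_mul_I w
    rw [cayley_apply] at h1
    have h2 : (2 * Complex.I) • (x : H) = 0 := by rw [← h1]; module
    have h3 : x = 0 := Subtype.ext ((smul_eq_zero.mp h2).resolve_left (by simp))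
    refine Subtype.ext ?_
    simp [h3]
  obtain ⟨⟨w, hw⟩, h⟩ := LinearMap.injective_iff_surjective.mp hA ⟨v, hv⟩
  have h1 : w - cayley T w = v := congrArg Subtype.val h
  obtain ⟨x, rfl⟩ := exists_add_smul_eq T.isSelfAdjoint Complex.I_mul_I w
  have h4 := hF _ hw
  rw [cayley_apply] at h1 h4
  refine ⟨(2 * Complex.I) • x, ?_, ?_⟩
  · rw [← h1]
    push_cast
    module
  · rw [LinearPMap.map_smul]
    have h5 : (2 * Complex.I) • T.op x = Complex.I • ((T.op x + Complex.I • (x : H))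
      + (T.op x - Complex.I • (x : H))) := by module
    rw [h5]
    exact F.smul_mem _ (F.add_mem hw h4)

/-- `T` restricts to a symmetric operator on the finite-dimensional `F`, which is diagonalizable
with real eigenvalues. -/
theorem le_span_eigenvectors_of_invariant (T : CFsa H) (F : Submodule ℂ H)
    [FiniteDimensional ℂ F] (hF : ∀ v ∈ F, cayley T v ∈ F) :
    F ≤ Submodule.span ℂ {v : H | v ∈ F ∧ v ≠ 0 ∧ ∃ (x : T.op.domain) (μ : ℝ), (x : H) = v ∧
      T.op x = (μ : ℂ) • v} := by
  have hd : F ≤ T.op.domain := fun v hv => by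
    obtain ⟨x, rfl, -⟩ := exists_domain_of_invariant T F hF hv
    exact x.2
  let A : F →ₗ[ℂ] F := (T.op.toFun ∘ₗ Submodule.inclusion hd).codRestrict F fun v => by
    obtain ⟨x, hx, hx2⟩ := exists_domain_of_invariant T F hF v.2
    have : Submodule.inclusion hd v = x := Subtype.ext hx.symm
    change T.op (Submodule.inclusion hd v) ∈ F
    rwa [this]
  have hAv : ∀ v : F, ((A v : F) : H) = T.op (Submodule.inclusion hd v) := fun v => rfl
  have hA : A.IsSymmetric := fun v w =>
    symmetric_of_isSelfAdjoint T.isSelfAdjoint (Submodule.inclusion hd v)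
      (Submodule.inclusion hd w)
  have htop : (⨆ μ, Module.End.eigenspace A μ) = ⊤ :=
    Submodule.orthogonal_eq_bot_iff.mp hA.orthogonalComplement_iSup_eigenspaces_eq_bot
  intro v hv
  have hle : (⨆ μ, Module.End.eigenspace A μ) ≤ (Submodule.span ℂ {v : H | v ∈ F ∧ v ≠ 0 ∧
      ∃ (x : T.op.domain) (μ : ℝ), (x : H) = v ∧ T.op x = (μ : ℂ) • v}).comap F.subtype := by
    refine iSup_le fun μ w hw => ?_
    rcases eq_or_ne w 0 with rfl | h0
    · exact Submodule.zero_mem _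
    have hμ := hA.conj_eigenvalue_eq_self
      (Module.End.hasEigenvalue_of_hasEigenvector ⟨hw, h0⟩)
    rw [Module.End.mem_eigenspace_iff] at hw
    obtain ⟨r, hr⟩ := Complex.conj_eq_iff_real.mp hμ
    refine Submodule.subset_span ⟨w.2, by simpa using h0, Submodule.inclusion hd w, r, rfl, ?_⟩
    rw [← hAv, hw, hr]
    rfl
  exact hle (show (⟨v, hv⟩ : F) ∈ _ by rw [htop]; trivial)

theorem cayley_mem_range_spectralProjection (T : CFsa H) (a b : ℝ) :
    ∀ v ∈ (spectralProjection T a b).range, cayley T v ∈ (spectralProjection T a b).range := by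
  rintro _ ⟨u, rfl⟩
  exact ⟨cayley T u, indicatorNormal_apply_comm _ _ _⟩

theorem range_spectralProjection_eq (T : CFsa H) (a b : ℝ)
    [FiniteDimensional ℂ (spectralProjection T a b).range] :
    (spectralProjection T a b).range = eigenSpan T (Set.Icc a b) := by
  refine le_antisymm ?_ (Submodule.span_le.mpr ?_)
  · refine (le_span_eigenvectors_of_invariant T _
      (cayley_mem_range_spectralProjection T a b)).trans (Submodule.span_mono ?_)
    rintro v ⟨hv, h0, x, μ, rfl, hx⟩
    exact ⟨x, μ, rfl, mem_Icc_of_eigenvector_mem_range T hx h0 hv, hx⟩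
  · rintro v ⟨x, μ, rfl, hμ, hx⟩
    exact ⟨x, spectralProjection_apply_eigenvector T hx hμ⟩

/-- Describes the range of `E^≥` by eigenvalues alone, so that different `ε` can be compared. -/
theorem nonnegSubspace_spectralProjection_eq (T : CFsa H) (ε : ℝ) :
    nonnegSubspace T (spectralProjection T (-ε) ε) = eigenSpan T (Set.Icc 0 ε) := by
  refine le_antisymm (Submodule.span_le.mpr ?_) (Submodule.span_le.mpr ?_)
  · rintro v ⟨hv, x, μ, rfl, h0, hx⟩
    rcases eq_or_ne (x : H) 0 with h | h
    · rw [h]; exact Submodule.zero_mem _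
    · exact Submodule.subset_span
        ⟨x, μ, rfl, ⟨h0, (mem_Icc_of_eigenvector_mem_range T hx h hv).2⟩, hx⟩
  · rintro v ⟨x, μ, rfl, hμ, hx⟩
    exact Submodule.subset_span ⟨⟨x, spectralProjection_apply_eigenvector T hx
      ⟨by linarith [hμ.1, hμ.2], hμ.2⟩⟩, x, μ, rfl, hμ.1, hx⟩

/-! ### Ranks of nearby projections -/

/-- `Q` is injective on the range of `P`: if `Pv = v` and `Qv = 0`, then `‖v‖ = ‖(P - Q)v‖`, which
forces `v = 0`. -/
theorem finrank_range_le_of_norm_sub_lt_one {H : Type*} [NormedAddCommGroup H]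
    [InnerProductSpace ℂ H] {P Q : H →L[ℂ] H}
    (hP : ∀ v ∈ P.range, P v = v) (h : ‖P - Q‖ < 1) [FiniteDimensional ℂ Q.range] :
    FiniteDimensional ℂ P.range ∧
      Module.finrank ℂ P.range ≤ Module.finrank ℂ Q.range := by
  let A : P.range →ₗ[ℂ] Q.range := Q.toLinearMap.rangeRestrict ∘ₗ P.range.subtype
  have hA : Function.Injective A := by
    rw [injective_iff_map_eq_zero]
    rintro ⟨v, hv⟩ h0
    have h1 : Q v = 0 := congrArg Subtype.val h0
    have h2 : (P - Q) v = v := by rw [sub_apply, hP v hv, h1, sub_zero]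
    have h3 := (P - Q).le_opNorm v
    rw [h2] at h3
    have h4 : ‖v‖ = 0 := by nlinarith [norm_nonneg v]
    exact Subtype.ext (norm_eq_zero.mp h4)
  exact ⟨FiniteDimensional.of_injective A hA, LinearMap.finrank_le_finrank_of_injective hA⟩

/-! ### Existence of admissible choices -/

theorem exists_nhds_continuousOn_spectralProjection (T₀ : CFsa H) :
    ∃ ε > 0, ∃ V ∈ 𝓝 T₀, ContinuousOn (fun T => spectralProjection T (-ε) ε) V ∧
      ∀ T ∈ V, FiniteDimensional ℂ (spectralProjection T (-ε) ε).range := by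
  obtain ⟨c, hc, hgap⟩ := exists_gap_spectrum_cayley T₀
  -- The arc `κ([-ε, ε])` is `‖w + 1‖ ≤ r` on the circle. Since `r ≤ 2ε`, this choice gives `3r <
  -- c`.
  set ε : ℝ := c / 8 with hεdef
  have hε : 0 < ε := by positivity
  set r : ℝ := 2 * ε / √(ε ^ 2 + 1) with hrdef
  have hr : 0 < r := by positivity
  have hrc : 3 * r < c := by
    have h1 : (1 : ℝ) ≤ √(ε ^ 2 + 1) := Real.one_le_sqrt.mpr (by nlinarith)
    have h2 : r ≤ 2 * ε := div_le_self (by positivity) h1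
    linarith
  -- `h` exceeds `1/2` on the annulus `r < ‖w + 1‖ < 2r` and vanishes on the spectrum of `κ(T₀)`;
  -- smallness of `h(κ(T))`, an open condition, keeps the annulus free of spectrum. `g` drops from
  -- `1` to `0` across that annulus.
  let h : ℂ → ℂ := fun w => ((max 0 (1 - |‖w + 1‖ - 3 * r / 2| / r) : ℝ) : ℂ)
  let g : ℂ → ℂ := fun w => ((max 0 (min 1 (2 - ‖w + 1‖ / r)) : ℝ) : ℂ)
  have hh : Continuous h := by fun_prop
  have hg : Continuous g := by fun_prop
  have hh0 : cfc h (cayley T₀) = 0 := by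
    rw [← cfc_zero ℂ (cayley T₀)]
    refine cfc_congr fun z hz => ?_
    have h1 : r ≤ |‖z + 1‖ - 3 * r / 2| := by
      by_cases hz1 : ‖z + 1‖ < c
      · rw [hgap z hz hz1]
        simp
        rw [abs_of_pos (by positivity)]
        linarith
      · rw [abs_of_nonneg (by linarith)]
        linarith
    have h2 : 1 - |‖z + 1‖ - 3 * r / 2| / r ≤ 0 := by
      rw [sub_nonpos, le_div_iff₀ hr]
      linarith
    change ((max 0 (1 - |‖z + 1‖ - 3 * r / 2| / r) : ℝ) : ℂ) = 0
    rw [max_eq_left h2]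
    simp
  set V : Set (CFsa H) := {T | ‖cfc h (cayley T)‖ < 1 / 2} ∩
    {T | ‖cfc g (cayley T) - cfc g (cayley T₀)‖ < 1} with hV
  have hVo : IsOpen V := by
    refine IsOpen.inter (isOpen_lt (continuous_cfc_cayley hh).norm continuous_const)
      (isOpen_lt ((continuous_cfc_cayley hg).sub continuous_const).norm continuous_const)
  have hT₀V : T₀ ∈ V := by
    refine ⟨?_, ?_⟩
    · simp [hh0]
    · simp
  have hE : ∀ T ∈ V, spectralProjection T (-ε) ε = cfc g (cayley T) := by
    intro T hT
    have hann : ∀ z ∈ spectrum ℂ (cayley T), ‖z + 1‖ ≤ r ∨ 2 * r ≤ ‖z + 1‖ := by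
      intro z hz
      by_contra! hcon
      have h1 := (norm_apply_le_norm_cfc h (cayley T) hz hh.continuousOn).trans_lt hT.1
      have h2 : |‖z + 1‖ - 3 * r / 2| / r < 1 / 2 := by
        rw [div_lt_iff₀ hr, abs_lt]
        constructor <;> linarith
      have h3 : ‖h z‖ = 1 - |‖z + 1‖ - 3 * r / 2| / r := by
        change ‖((max 0 (1 - |‖z + 1‖ - 3 * r / 2| / r) : ℝ) : ℂ)‖ = _
        rw [max_eq_right (by linarith), Complex.norm_real, Real.norm_of_nonneg (by linarith)]
      linarith
    refine indicatorNormal_eq_cfc _ hr (fun z hz hzK => ?_) (fun z hz hzK => ?_)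
    · have h1 : ‖z + 1‖ ≤ r := ((mem_cayleyPoint_image_iff hε).mp hzK).2
      have h2 : (1 : ℝ) ≤ 2 - ‖z + 1‖ / r := by
        have : ‖z + 1‖ / r ≤ 1 := (div_le_one hr).mpr h1
        linarith
      change ((max 0 (min 1 (2 - ‖z + 1‖ / r)) : ℝ) : ℂ) = 1
      rw [min_eq_left h2]
      simp
    · have h1 : 2 * r ≤ ‖z + 1‖ := (hann z hz).resolve_left fun h1 => hzK
        ((mem_cayleyPoint_image_iff hε).mpr ⟨norm_eq_one_of_mem_spectrum_cayley T hz, h1⟩)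
      constructor
      · have h2 : 2 - ‖z + 1‖ / r ≤ 0 := by
          rw [sub_nonpos, le_div_iff₀ hr]
          exact h1
        change ((max 0 (min 1 (2 - ‖z + 1‖ / r)) : ℝ) : ℂ) = 0
        rw [max_eq_left ((min_le_right _ _).trans h2)]
        simp
      · intro h2
        obtain ⟨w, hw, hd⟩ := Metric.mem_thickening_iff.mp h2
        have h3 : ‖w + 1‖ ≤ r := ((mem_cayleyPoint_image_iff hε).mp hw).2
        rw [dist_eq_norm] at hd
        have h4 : ‖z + 1‖ ≤ ‖z - w‖ + ‖w + 1‖ := by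
          refine le_trans (le_of_eq ?_) (norm_add_le _ _)
          congr 1
          ring
        linarith
  -- `(w + 1) g(w)` vanishes on the spectrum of `κ(T₀)`, so `g(κ(T₀))` maps into the kernel of
  -- `κ(T₀) + 1`. Finite rank passes to `T ∈ V` by comparison of nearby projections.
  have hfin₀ : FiniteDimensional ℂ (cfc g (cayley T₀)).range := by
    have := finiteDimensional_ker_cayley_add_one T₀
    refine Submodule.finiteDimensional_of_le (S₂ := (cayley T₀ + 1 : H →L[ℂ] H).ker) ?_
    have hid : Continuous fun w : ℂ => w + 1 := by fun_prop
    have hW : cfc (fun w : ℂ => w + 1) (cayley T₀) = cayley T₀ + 1 := by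
      rw [cfc_add_const (1 : ℂ) (fun w : ℂ => w) (cayley T₀), cfc_id' ℂ (cayley T₀)]
      simp
    have h0 : (cayley T₀ + 1) * cfc g (cayley T₀) = 0 := by
      rw [← hW, ← cfc_mul _ _ (cayley T₀) hid.continuousOn hg.continuousOn,
        ← cfc_zero ℂ (cayley T₀)]
      refine cfc_congr fun z hz => ?_
      by_cases hz1 : ‖z + 1‖ < c
      · simp [hgap z hz hz1]
      · have h2 : 2 - ‖z + 1‖ / r ≤ 0 := by
          rw [sub_nonpos, le_div_iff₀ hr]
          linarith
        change (z + 1) * ((max 0 (min 1 (2 - ‖z + 1‖ / r)) : ℝ) : ℂ) = 0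
        rw [max_eq_left ((min_le_right _ _).trans h2)]
        simp
    rintro _ ⟨u, rfl⟩
    exact congrArg (fun A : H →L[ℂ] H => A u) h0
  refine ⟨ε, hε, V, hVo.mem_nhds hT₀V, (continuous_cfc_cayley hg).continuousOn.congr hE,
    fun T hT => ?_⟩
  refine (finrank_range_le_of_norm_sub_lt_one (Q := cfc g (cayley T₀))
    (fun v hv => spectralProjection_apply_of_mem_range T hv) ?_).1
  rw [hE T hT]
  exact hT.2

theorem nonempty_flowData (f : C(I, CFsa H)) : Nonempty (FlowData f) := by
  choose ε hε V hV hcont hfin using fun s => exists_nhds_continuousOn_spectralProjection (f s)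
  obtain ⟨δ, hδ, hball⟩ := lebesgue_number_lemma_of_metric (isCompact_univ (X := I))
    (c := fun s => interior (f ⁻¹' V s)) (fun s => isOpen_interior)
    (fun s _ => Set.mem_iUnion.mpr
      ⟨s, mem_interior_iff_mem_nhds.mpr (f.continuous.continuousAt.preimage_mem_nhds (hV s))⟩)
  -- The uniform partition into `m + 1` intervals has mesh below the Lebesgue number `δ`.
  obtain ⟨m, hm⟩ := exists_nat_one_div_lt hδ
  let t : Fin (m + 1 + 1) → I := fun k => ⟨(k : ℝ) / ((m : ℝ) + 1), by positivity, by
    have : (k : ℕ) ≤ m + 1 := Nat.lt_succ_iff.mp k.2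
    have h1 : ((k : ℕ) : ℝ) ≤ (m : ℝ) + 1 := by exact_mod_cast this
    exact (div_le_one (by positivity)).mpr h1⟩
  choose i hi using fun k : Fin (m + 1) => hball (t k.castSucc) trivial
  have hsub : ∀ k : Fin (m + 1), Set.MapsTo f (Set.Icc (t k.castSucc) (t k.succ)) (V (i k)) := by
    intro k s hs
    refine interior_subset (s := f ⁻¹' V (i k)) (hi k ?_)
    have h1 : ((k : ℕ) : ℝ) / ((m : ℝ) + 1) ≤ (s : ℝ) := hs.1
    have h2 : (s : ℝ) ≤ (((k : ℕ) + 1 : ℕ) : ℝ) / ((m : ℝ) + 1) := hs.2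
    rw [Metric.mem_ball, Subtype.dist_eq, Real.dist_eq]
    change |(s : ℝ) - ((k : ℕ) : ℝ) / ((m : ℝ) + 1)| < δ
    rw [abs_of_nonneg (by linarith)]
    push_cast at h2
    rw [add_div] at h2
    linarith
  exact ⟨{
    n := m + 1
    t := t
    ε := fun k => ε (i k)
    strictMono_t := fun j k hjk => by
      change ((j : ℕ) : ℝ) / ((m : ℝ) + 1) < ((k : ℕ) : ℝ) / ((m : ℝ) + 1)
      have : ((j : ℕ) : ℝ) < ((k : ℕ) : ℝ) := by exact_mod_cast hjk
      gcongr
    t_zero := Subtype.ext (by simp [t])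
    t_last := Subtype.ext (by
      change ((m + 1 : ℕ) : ℝ) / ((m : ℝ) + 1) = 1
      push_cast
      exact div_self (by positivity))
    ε_pos := fun k => hε (i k)
    continuousOn := fun k =>
      (hcont (i k)).comp f.continuous.continuousOn (hsub k)
    finiteRank := fun k s hs => hfin (i k) _ (hsub k hs) }⟩

/-! ### Comparison of two spectral cut-offs -/

/-- A continuous function which is `1` on the image of `[ε, ε']` and `0` on the image of
`(-∞, 0]` under the Cayley transform. -/
noncomputable def positiveCutoff (ε ε' : ℝ) (z : ℂ) : ℂ :=
  ((max 0 (min 1 (-z.im * ((ε' ^ 2 + 1) / (2 * ε)))) : ℝ) : ℂ)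

theorem continuous_positiveCutoff (ε ε' : ℝ) : Continuous (positiveCutoff ε ε') := by
  unfold positiveCutoff
  fun_prop

theorem neg_im_cayleyPoint (x : ℝ) : -(cayleyPoint x).im = 2 * x / (x ^ 2 + 1) := by
  unfold cayleyPoint
  rw [Complex.div_im, Complex.normSq_apply]
  simp
  field_simp
  ring

/-- On `[ε, ε']` the quantity `-Im κ(x) = 2x/(x² + 1)` is at least `2ε/(ε'² + 1)`, the inverse of
the scaling factor in the cut-off. -/
theorem positiveCutoff_eq_one {ε ε' x : ℝ} (hε : 0 < ε) (h1 : ε ≤ x) (h2 : x ≤ ε') :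
    positiveCutoff ε ε' (cayleyPoint x) = 1 := by
  unfold positiveCutoff
  rw [neg_im_cayleyPoint, min_eq_left]
  · simp
  · have hx : 0 < x := hε.trans_le h1
    rw [div_mul_div_comm, one_le_div (by positivity)]
    have : x ^ 2 ≤ ε' ^ 2 := by gcongr
    nlinarith [mul_le_mul h1 this (by positivity) hx.le]

theorem positiveCutoff_eq_zero {ε ε' x : ℝ} (hε : 0 < ε) (h1 : x ≤ 0) :
    positiveCutoff ε ε' (cayleyPoint x) = 0 := by
  unfold positiveCutoff
  rw [neg_im_cayleyPoint, max_eq_left]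
  · simp
  · refine (min_le_right _ _).trans (mul_nonpos_of_nonpos_of_nonneg ?_ (by positivity))
    exact div_nonpos_of_nonpos_of_nonneg (by linarith) (by positivity)

/-- The spectral projection of `T` for `(ε, ε']`, written as a continuous function of the Cayley
transform and of the spectral projections for `[-ε, ε]` and `[-ε', ε']`. -/
noncomputable def positiveDifference (T : CFsa H) (ε ε' : ℝ) : H →L[ℂ] H :=
  cfc (positiveCutoff ε ε') (cayley T) * (1 - spectralProjection T (-ε) ε) *
    spectralProjection T (-ε') ε'

/-- The cut-off need not be an indicator on `(0, ε)`, but `1 - E` kills every eigenvector with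
eigenvalue in `[-ε, ε]`. The remaining eigenvalues are separated by their sign. -/
theorem positiveDifference_apply_eigenvector (T : CFsa H) {ε ε' : ℝ} (hε : 0 < ε)
    {x : T.op.domain} {μ : ℝ} (hx : T.op x = (μ : ℂ) • (x : H)) (hμ : μ ∈ Set.Icc (-ε') ε') :
    cfc (positiveCutoff ε ε') (cayley T) ((1 - spectralProjection T (-ε) ε) (x : H)) =
      if ε < μ then (x : H) else 0 := by
  by_cases h : μ ∈ Set.Icc (-ε) ε
  · rw [if_neg h.2.not_gt, sub_apply, spectralProjection_apply_eigenvector T hx h]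
    simp
  · rw [sub_apply, spectralProjection_apply_eigenvector_of_notMem T hx h, sub_zero,
      one_apply_eq_self,
      cfc_apply_eigenvector _ (cayley_apply_eigenvector T hx) (continuous_positiveCutoff ε ε')]
    split_ifs with h1
    · rw [positiveCutoff_eq_one hε h1.le hμ.2, one_smul]
    · have h2 : μ < -ε := by
        by_contra h2
        exact h ⟨not_lt.mp h2, not_lt.mp h1⟩
      rw [positiveCutoff_eq_zero hε (by linarith), zero_smul]

theorem positiveDifference_apply_of_mem (T : CFsa H) {ε ε' : ℝ} (hε : 0 < ε) {v : H}
    (hv : v ∈ eigenSpan T (Set.Ioc ε ε')) : positiveDifference T ε ε' v = v := by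
  have h : eigenSpan T (Set.Ioc ε ε') ≤
      LinearMap.eqLocus (positiveDifference T ε ε').toLinearMap LinearMap.id := by
    refine Submodule.span_le.mpr ?_
    rintro _ ⟨x, μ, rfl, hμ, hx⟩
    have hμ' : μ ∈ Set.Icc (-ε') ε' := ⟨by linarith [hμ.1, hμ.2], hμ.2⟩
    change cfc (positiveCutoff ε ε') (cayley T) ((1 - spectralProjection T (-ε) ε)
      (spectralProjection T (-ε') ε' (x : H))) = x
    rw [spectralProjection_apply_eigenvector T hx hμ',
      positiveDifference_apply_eigenvector T hε hx hμ', if_pos hμ.1]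
  exact h hv

theorem range_positiveDifference (T : CFsa H) {ε ε' : ℝ} (hε : 0 < ε)
    [FiniteDimensional ℂ (spectralProjection T (-ε') ε').range] :
    (positiveDifference T ε ε').range = eigenSpan T (Set.Ioc ε ε') := by
  refine le_antisymm ?_ fun v hv => ⟨v, positiveDifference_apply_of_mem T hε hv⟩
  rintro _ ⟨u, rfl⟩
  have h : eigenSpan T (Set.Icc (-ε') ε') ≤ (eigenSpan T (Set.Ioc ε ε')).comap
      (cfc (positiveCutoff ε ε') (cayley T) *
        (1 - spectralProjection T (-ε) ε) : H →L[ℂ] H).toLinearMap := by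
    refine Submodule.span_le.mpr ?_
    rintro _ ⟨x, μ, rfl, hμ, hx⟩
    change cfc (positiveCutoff ε ε') (cayley T) ((1 - spectralProjection T (-ε) ε) (x : H)) ∈
      eigenSpan T (Set.Ioc ε ε')
    rw [positiveDifference_apply_eigenvector T hε hx hμ]
    split_ifs with h1
    · exact Submodule.subset_span ⟨x, μ, rfl, ⟨h1, hμ.2⟩, hx⟩
    · exact Submodule.zero_mem _
  rw [← range_spectralProjection_eq] at h
  exact h ⟨u, rfl⟩

theorem eigenSpan_union (T : CFsa H) (S S' : Set ℝ) :
    eigenSpan T (S ∪ S') = eigenSpan T S ⊔ eigenSpan T S' := by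
  unfold eigenSpan
  rw [← Submodule.span_union]
  congr 1
  ext v
  constructor
  · rintro ⟨x, μ, hx, hμ | hμ, hT⟩
    · exact Or.inl ⟨x, μ, hx, hμ, hT⟩
    · exact Or.inr ⟨x, μ, hx, hμ, hT⟩
  · rintro (⟨x, μ, hx, hμ, hT⟩ | ⟨x, μ, hx, hμ, hT⟩)
    · exact ⟨x, μ, hx, Or.inl hμ, hT⟩
    · exact ⟨x, μ, hx, Or.inr hμ, hT⟩

theorem finrank_eigenSpan_eq_add (T : CFsa H) {ε ε' : ℝ} (hε : 0 < ε) (hle : ε ≤ ε')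
    [FiniteDimensional ℂ (spectralProjection T (-ε') ε').range] :
    Module.finrank ℂ (eigenSpan T (Set.Icc 0 ε')) =
      Module.finrank ℂ (eigenSpan T (Set.Icc 0 ε)) +
        Module.finrank ℂ (positiveDifference T ε ε').range := by
  have hfin : ∀ S ⊆ Set.Icc (-ε') ε', FiniteDimensional ℂ (eigenSpan T S) := fun S hS => by
    refine Submodule.finiteDimensional_of_le (S₂ := (spectralProjection T (-ε') ε').range) ?_
    rw [range_spectralProjection_eq]
    exact eigenSpan_mono T hS
  have := hfin (Set.Icc 0 ε) (Set.Icc_subset_Icc (by linarith) hle)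
  have := hfin (Set.Ioc ε ε') fun x hx => ⟨by linarith [hx.1, hx.2], hx.2⟩
  -- The projection for `[-ε, ε]` is the identity on the first space and zero on the second.
  have hdisj : eigenSpan T (Set.Icc 0 ε) ⊓ eigenSpan T (Set.Ioc ε ε') = ⊥ := by
    rw [eq_bot_iff]
    rintro v ⟨h1, h2⟩
    have e1 : eigenSpan T (Set.Icc 0 ε) ≤
        LinearMap.eqLocus (spectralProjection T (-ε) ε).toLinearMap LinearMap.id := by
      refine Submodule.span_le.mpr ?_
      rintro _ ⟨x, μ, rfl, hμ, hx⟩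
      exact spectralProjection_apply_eigenvector T hx ⟨by linarith [hμ.1], hμ.2⟩
    have e2 : eigenSpan T (Set.Ioc ε ε') ≤ (spectralProjection T (-ε) ε).ker := by
      refine Submodule.span_le.mpr ?_
      rintro _ ⟨x, μ, rfl, hμ, hx⟩
      exact spectralProjection_apply_eigenvector_of_notMem T hx fun h => hμ.1.not_ge h.2
    exact (Eq.symm (e1 h1)).trans (e2 h2)
  have h := Submodule.finrank_sup_add_finrank_inf_eq (eigenSpan T (Set.Icc 0 ε))
    (eigenSpan T (Set.Ioc ε ε'))
  rw [hdisj, finrank_bot, add_zero, ← eigenSpan_union, Set.Icc_union_Ioc_eq_Icc hε.le hle] at h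
  rw [h, range_positiveDifference T hε]

/-- `dim E^≥` for `E = 1_{[-ε, ε]}(T)`. -/
noncomputable def nonnegRank (T : CFsa H) (ε : ℝ) : ℤ :=
  Module.finrank ℂ (nonnegSubspace T (spectralProjection T (-ε) ε))

/-- `s ↦ 1_{[-ε, ε]}(f s)` is norm continuous and of finite rank on `S`. -/
def IsAdmissible (f : C(I, CFsa H)) (ε : ℝ) (S : Set I) : Prop :=
  ContinuousOn (fun s => spectralProjection (f s) (-ε) ε) S ∧
    ∀ s ∈ S, FiniteDimensional ℂ (spectralProjection (f s) (-ε) ε).range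

theorem IsAdmissible.mono {f : C(I, CFsa H)} {ε : ℝ} {S S' : Set I} (h : IsAdmissible f ε S)
    (hS : S' ⊆ S) : IsAdmissible f ε S' :=
  ⟨h.1.mono hS, fun s hs => h.2 s (hS hs)⟩

/-- The two ranks differ by the rank `k` of `positiveDifference`, a norm continuous family of
finite-rank idempotents on `S`. Nearby idempotents have equal rank, so `k` is locally constant,
hence constant on `S`. -/
theorem nonnegRank_sub_eq_of_le (f : C(I, CFsa H)) {ε ε' : ℝ} (hε : 0 < ε) (hle : ε ≤ ε')
    {S : Set I} (hS : IsPreconnected S) (h : IsAdmissible f ε S) (h' : IsAdmissible f ε' S)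
    {s u : I} (hs : s ∈ S) (hu : u ∈ S) :
    nonnegRank (f u) ε - nonnegRank (f s) ε = nonnegRank (f u) ε' - nonnegRank (f s) ε' := by
  let k : I → ℕ := fun s => Module.finrank ℂ (positiveDifference (f s) ε ε').range
  have hrank : ∀ s ∈ S, nonnegRank (f s) ε' = nonnegRank (f s) ε + k s := fun s hs => by
    have := h'.2 s hs
    unfold nonnegRank
    rw [nonnegSubspace_spectralProjection_eq, nonnegSubspace_spectralProjection_eq,
      finrank_eigenSpan_eq_add (f s) hε hle]
    push_cast
    rfl
  have hcont : ContinuousOn (fun s => positiveDifference (f s) ε ε') S :=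
    (((continuous_cfc_cayley (continuous_positiveCutoff ε ε')).comp
      f.continuous).continuousOn.mul (continuousOn_const.sub h.1)).mul h'.1
  have hidem : ∀ s ∈ S, (∀ v ∈ (positiveDifference (f s) ε ε').range,
      positiveDifference (f s) ε ε' v = v) ∧
      FiniteDimensional ℂ (positiveDifference (f s) ε ε').range := fun s hs => by
    have := h'.2 s hs
    refine ⟨fun v hv => ?_, ?_⟩
    · rw [range_positiveDifference (f s) hε] at hv
      exact positiveDifference_apply_of_mem (f s) hε hv
    · rw [range_positiveDifference (f s) hε]
      refine Submodule.finiteDimensional_of_le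
        (S₂ := (spectralProjection (f s) (-ε') ε').range) ?_
      rw [range_spectralProjection_eq]
      exact eigenSpan_mono _ fun x hx => ⟨by linarith [hx.1, hx.2], hx.2⟩
  have hk : ContinuousOn k S := by
    intro s hs
    have h1 : ∀ᶠ w in 𝓝[S] s,
        ‖positiveDifference (f w) ε ε' - positiveDifference (f s) ε ε'‖ < 1 := by
      have h2 := ((hcont s hs).sub
        (continuousWithinAt_const (b := positiveDifference (f s) ε ε'))).norm.tendsto
      refine h2.eventually (gt_mem_nhds ?_)
      simp
    refine tendsto_const_nhds.congr' ?_
    filter_upwards [h1, self_mem_nhdsWithin] with w hw hwS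
    have := (hidem s hs).2
    have := (hidem w hwS).2
    exact le_antisymm
      (finrank_range_le_of_norm_sub_lt_one (hidem s hs).1 (by rwa [norm_sub_rev])).2
      (finrank_range_le_of_norm_sub_lt_one (hidem w hwS).1 hw).2
  rw [hrank s hs, hrank u hu, hS.constant hk hs hu]
  ring

theorem nonnegRank_sub_eq (f : C(I, CFsa H)) {ε ε' : ℝ} (hε : 0 < ε) (hε' : 0 < ε')
    {S : Set I} (hS : IsPreconnected S) (h : IsAdmissible f ε S) (h' : IsAdmissible f ε' S)
    {s u : I} (hs : s ∈ S) (hu : u ∈ S) :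
    nonnegRank (f u) ε - nonnegRank (f s) ε = nonnegRank (f u) ε' - nonnegRank (f s) ε' := by
  rcases le_total ε ε' with hle | hle
  · exact nonnegRank_sub_eq_of_le f hε hle hS h h' hs hu
  · exact (nonnegRank_sub_eq_of_le f hε' hle hS h' h hs hu).symm

/-! ### Independence of the choices -/

theorem sum_succ_sub_castSucc {n : ℕ} (h : Fin (n + 1) → ℤ) :
    ∑ j : Fin n, (h j.succ - h j.castSucc) = h (Fin.last n) - h 0 := by
  have h1 := Fin.sum_univ_succ h
  have h2 := Fin.sum_univ_castSucc h
  rw [Finset.sum_sub_distrib]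
  linarith

theorem sub_clamp_eq (g : I → ℤ) {p q : I} (hpq : p ≤ q) (s : I) :
    g (max p (min s q)) - g p = g (min s q) - g (min s p) := by
  rcases le_total s p with h | h
  · rw [min_eq_left h, min_eq_left (h.trans hpq), max_eq_left h]
    ring
  · rw [min_eq_right h, max_eq_right (le_min h hpq)]

/-- Clamping `a` and `b` to each interval of the partition cuts the increment of `g` into pieces.
This replaces a common refinement of two partitions. -/
theorem FlowData.sum_clamp {f : C(I, CFsa H)} (D : FlowData f) (g : I → ℤ) (a b : I) :
    ∑ k : Fin D.n, (g (max (D.t k.castSucc) (min b (D.t k.succ)))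
      - g (max (D.t k.castSucc) (min a (D.t k.succ)))) = g b - g a := by
  -- For increments starting at `0` the sum telescopes through the points `min s (t k)`.
  have key : ∀ s, ∑ k : Fin D.n, (g (max (D.t k.castSucc) (min s (D.t k.succ)))
      - g (D.t k.castSucc)) = g s - g 0 := by
    intro s
    have h1 := sum_succ_sub_castSucc fun k => g (min s (D.t k))
    rw [D.t_zero, D.t_last, min_eq_left (unitInterval.le_one' : s ≤ 1),
      min_eq_right (unitInterval.nonneg' : 0 ≤ s)] at h1
    rw [← h1]
    exact Finset.sum_congr rfl fun k _ =>
      sub_clamp_eq g (D.strictMono_t.monotone k.castSucc_lt_succ.le) s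
  have h2 : g b - g a = (g b - g 0) - (g a - g 0) := by ring
  rw [h2, ← key b, ← key a, ← Finset.sum_sub_distrib]
  exact Finset.sum_congr rfl fun k _ => by ring

/-- If the intervals are disjoint, both clamped increments vanish; otherwise both run over the
intersection, where both cut-offs are admissible. -/
theorem nonnegRank_clamp_sub_eq (f : C(I, CFsa H)) {ε ε' : ℝ} (hε : 0 < ε) (hε' : 0 < ε')
    {a b a' b' : I} (hab : a ≤ b) (hab' : a' ≤ b') (h : IsAdmissible f ε (Set.Icc a b))
    (h' : IsAdmissible f ε' (Set.Icc a' b')) :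
    nonnegRank (f (max a' (min b b'))) ε - nonnegRank (f (max a' (min a b'))) ε =
      nonnegRank (f (max a (min b' b))) ε' - nonnegRank (f (max a (min a' b))) ε' := by
  rcases lt_or_ge b a' with h1 | h1
  · rw [max_eq_left ((min_le_left b b').trans h1.le),
      max_eq_left ((min_le_left a b').trans (hab.trans h1.le)),
      min_eq_right (h1.le.trans hab'), min_eq_right h1.le]
    ring
  rcases lt_or_ge b' a with h2 | h2
  · rw [max_eq_left ((min_le_left b' b).trans h2.le),
      max_eq_left ((min_le_left a' b).trans (hab'.trans h2.le)),
      min_eq_right (h2.le.trans hab), min_eq_right h2.le]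
    ring
  rw [max_eq_right (le_min h1 hab'), max_eq_right (le_min h2 hab), min_eq_left h2,
    min_eq_left h1, min_comm b' b, max_comm a a']
  have hle : max a' a ≤ min b b' := max_le (le_min h1 hab') (le_min hab h2)
  exact nonnegRank_sub_eq f hε hε' (isPreconnected_Icc (a := max a' a) (b := min b b'))
    (h.mono (Set.Icc_subset_Icc (le_max_right _ _) (min_le_left _ _)))
    (h'.mono (Set.Icc_subset_Icc (le_max_left _ _) (min_le_right _ _)))
    (Set.left_mem_Icc.mpr hle) (Set.right_mem_Icc.mpr hle)

theorem FlowData.spectralFlow_eq {f : C(I, CFsa H)} (D D' : FlowData f) :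
    D.spectralFlow = D'.spectralFlow := by
  have hD : ∀ D : FlowData f, D.spectralFlow = ∑ j : Fin D.n,
      (nonnegRank (f (D.t j.succ)) (D.ε j) - nonnegRank (f (D.t j.castSucc)) (D.ε j)) :=
    fun D => rfl
  rw [hD, hD]
  have e1 := fun j : Fin D.n => D'.sum_clamp (fun s => nonnegRank (f s) (D.ε j))
    (D.t j.castSucc) (D.t j.succ)
  have e2 := fun k : Fin D'.n => D.sum_clamp (fun s => nonnegRank (f s) (D'.ε k))
    (D'.t k.castSucc) (D'.t k.succ)
  -- Each increment of one partition is split along the other; after exchanging the sums, the terms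
  -- agree for each pair of intervals.
  simp only [← e1, ← e2]
  rw [Finset.sum_comm]
  refine Finset.sum_congr rfl fun k _ => Finset.sum_congr rfl fun j _ => ?_
  exact nonnegRank_clamp_sub_eq f (D.ε_pos j) (D'.ε_pos k)
    (D.strictMono_t.monotone j.castSucc_lt_succ.le)
    (D'.strictMono_t.monotone k.castSucc_lt_succ.le)
    ⟨D.continuousOn j, D.finiteRank j⟩ ⟨D'.continuousOn k, D'.finiteRank k⟩

end GapFlow

theorem propositionp {H : Type*} [NormedAddCommGroup H] [InnerProductSpace ℂ H] [CompleteSpace H]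
    [TopologicalSpace.SeparableSpace H] (f : C(unitInterval, GapFlow.CFsa H)) :
    Nonempty (GapFlow.FlowData f) ∧
      ∀ D D' : GapFlow.FlowData f, D.spectralFlow = D'.spectralFlow :=
  ⟨GapFlow.nonempty_flowData f, fun D D' => D.spectralFlow_eq D'⟩
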